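/- **Variational principle for three-dimensional linear Cosserat elastodynamics (modified Hellinger–Prange–Reissner principle).** *Setting.* Let $B_0\subset\mathbb R^3$ be a bounded open set with Lipschitz boundary, with outward unit normal $\mathbf n$ (defined almost everywhere on $\partial B_0$) and surface measure $da$. Let $\mathcal G_2\subset\partial B_0$ be measurable, $\mathcal G_1=\partial B_0\setminus\mathcal G_2$, and let $t_0<t_k$. Let $\lambda,\mu,\alpha,\beta,\gamma,\epsilon$ be real constants with $\mu,\alpha,\gamma,\epsilon,\ \lambda+\tfrac23\mu,\ \beta+\tfrac23\gamma$ all nonzero, and put $$\mu'=\tfrac1{4\mu},\quad \alpha'=\tfrac1{4\alpha},\quad \gamma'=\tfrac1{4\gamma},\quad \epsilon'=\tfrac1{4\epsilon},\quad \lambda'=\frac{-\lambda}{6\mu(\lambda+\frac{2\mu}3)},\quad \beta'=\frac{-\beta}{6\gamma(\beta+\frac{2\gamma}3)} .$$ Let $\rho$ be the (constant) density and $\mathbf J$ the (constant, symmetric) rotatory inertia tensor. Let $\mathbf u_0,\boldsymbol\phi_0$ be integrable vector fields on $\mathcal G_1\times[t_0,t_k]$ and $\boldsymbol\sigma_0,\boldsymbol\mu_0$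 integrable vector fields on $\mathcal G_2\times[t_0,t_k]$. *Conventions.* $\varepsilon_{ijk}$ is the Levi-Civita symbol, $(\boldsymbol\varepsilon\cdot\mathbf v)_{ij}=\varepsilon_{ijk}v_k$ for a vector $\mathbf v$, $(\boldsymbol\varepsilon\cdot\mathbf A)_i=\varepsilon_{ijk}A_{kj}$ for a tensor $\mathbf A$, $(\nabla\mathbf u)_{ij}=\partial_iu_j$, $(\mathbf{div}\,\mathbf A)_i=\partial_jA_{ij}$, $\mathbf A\cdot\mathbf B=A_{ij}B_{ij}$, $(\mathbf A_{\mathbf n})_i=(\mathbf A\cdot\mathbf n)_i=A_{ij}n_j$ (summation over repeated indices). *States.* A state $\mathfrak s=[\mathbf u,\boldsymbol\phi,\boldsymbol\gamma,\boldsymbol\chi,\boldsymbol\sigma,\boldsymbol\mu]$ consists of time-dependent vector fields $\mathbf u,\boldsymbol\phi$ (displacement, rotation) of class $C^2$ and tensor fields $\boldsymbol\gamma,\boldsymbol\chi,\boldsymbol\sigma,\boldsymbol\mu$ (strain, torsion, stress, couple stress) of class $C^1$ on $[t_0,t_k]\times\overline{B_0}$, each being the restriction of a field of the same class on $\mathbb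 R\times\mathbb R^3$. Its momenta are $\mathbf p=\rho\,\partial_t\mathbf u$ and $\mathbf q=\mathbf J\,\partial_t\boldsymbol\phi$. The state is *admissible* if on $[t_0,t_k]\times B_0$ $$\boldsymbol\gamma=(\nabla\mathbf u)^T+\boldsymbol\varepsilon\cdot\boldsymbol\phi,\qquad \boldsymbol\chi=(\nabla\boldsymbol\phi)^T .$$ *Functional.* With $$\Phi\{\boldsymbol\sigma,\boldsymbol\mu\}=\tfrac{\mu'+\alpha'}2\sigma_{ij}\sigma_{ij}+\tfrac{\mu'-\alpha'}2\sigma_{ij}\sigma_{ji}+\tfrac{\lambda'}2\sigma_{kk}\sigma_{nn}+\tfrac{\gamma'+\epsilon'}2\mu_{ij}\mu_{ij}+\tfrac{\gamma'-\epsilon'}2\mu_{ij}\mu_{ji}+\tfrac{\beta'}2\mu_{kk}\mu_{nn},$$ $$U_K=\int_{B_0}\Phi\{\boldsymbol\sigma,\boldsymbol\mu\}\,dv,\qquad T_C=\tfrac12\int_{B_0}\bigl(\rho\,\partial_t\mathbf u\cdot\partial_t\mathbf u+\partial_t\boldsymbol\phi\cdot\mathbf J\,\partial_t\boldsymbol\phi\bigr)dv,$$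 let $$\begin{aligned}\Theta(\mathfrak s)={}&\int_{t_0}^{t_k}(U_K-T_C)\,dt+\int_{t_0}^{t_k}\!\!\int_{B_0}\bigl(-\boldsymbol\sigma\cdot\boldsymbol\gamma-\boldsymbol\mu\cdot\boldsymbol\chi+\mathbf p\cdot\partial_t\mathbf u+\mathbf q\cdot\partial_t\boldsymbol\phi\bigr)dv\,dt\\&+\int_{t_0}^{t_k}\!\!\int_{\mathcal G_1}\bigl[\boldsymbol\sigma_{\mathbf n}\cdot(\mathbf u-\mathbf u_0)+\boldsymbol\mu_{\mathbf n}\cdot(\boldsymbol\phi-\boldsymbol\phi_0)\bigr]da\,dt+\int_{t_0}^{t_k}\!\!\int_{\mathcal G_2}\bigl[\boldsymbol\sigma_0\cdot\mathbf u+\boldsymbol\mu_0\cdot\boldsymbol\phi\bigr]da\,dt .\end{aligned}$$ (As $\mathbf p\cdot\partial_t\mathbf u+\mathbf q\cdot\partial_t\boldsymbol\phi$ integrates over $B_0$ to $2T_C$, the net kinetic contribution to $\Theta$ is $+\int_{t_0}^{t_k}T_C\,dt$.) We say that $\delta\Theta(\mathfrak s)=0$ if $\frac{d}{d\eta}\Theta(\mathfrak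 s+\eta\,\delta\mathfrak s)\big|_{\eta=0}$ exists and equals $0$ for every admissible state $\delta\mathfrak s$ whose displacement, rotation and momenta $\delta\mathbf u,\delta\boldsymbol\phi,\delta\mathbf p,\delta\mathbf q$ vanish in $B_0$ at $t=t_0$ and $t=t_k$. *Principle.* For every admissible state $\mathfrak s$, $\delta\Theta(\mathfrak s)=0$ if and only if all of the following hold. 1. Balance laws on $[t_0,t_k]\times B_0$: $\ \mathbf{div}\,\boldsymbol\sigma=\partial_t\mathbf p$ and $\boldsymbol\varepsilon\cdot\boldsymbol\sigma+\mathbf{div}\,\boldsymbol\mu=\partial_t\mathbf q$. 2. Inverse constitutive relations on $[t_0,t_k]\times B_0$: $\ \boldsymbol\gamma=(\mu'+\alpha')\boldsymbol\sigma+(\mu'-\alpha')\boldsymbol\sigma^T+\lambda'(\mathrm{tr}\,\boldsymbol\sigma)\mathbf 1$ and $\boldsymbol\chi=(\gamma'+\epsilon')\boldsymbol\mu+(\gamma'-\epsilon')\boldsymbol\mu^T+\beta'(\mathrm{tr}\,\boldsymbol\mu)\mathbf 1$. 3. Mixed boundary conditions, almost everywhere with respect to $da\,dt$: $\ \mathbf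 u=\mathbf u_0$, $\boldsymbol\phi=\boldsymbol\phi_0$ on $\mathcal G_1\times[t_0,t_k]$, and $\boldsymbol\sigma_{\mathbf n}=\boldsymbol\sigma_0$, $\boldsymbol\mu_{\mathbf n}=\boldsymbol\mu_0$ on $\mathcal G_2\times[t_0,t_k]$. -/

import Mathlib

open MeasureTheory Matrix Topology

namespace Cosserat

/-! ### Points, vectors, tensors -/

/-- Physical space, with its Euclidean norm, inner product and Lebesgue measure. -/
abbrev Space := EuclideanSpace ℝ (Fin 3)

/-- Cartesian components of a vector. -/
abbrev Vec := Fin 3 → ℝ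

/-- Cartesian components of a (not necessarily symmetric) second order tensor. -/
abbrev Tensor := Matrix (Fin 3) (Fin 3) ℝ

/-- The Levi-Civita symbol `ε i j k`. -/
noncomputable def leviCivita (i j k : Fin 3) : ℝ :=
  ((j : ℝ) - (i : ℝ)) * ((k : ℝ) - (i : ℝ)) * ((k : ℝ) - (j : ℝ)) / 2

/-- `(ε · v) i j = ∑ k, ε i j k * v k`. -/
noncomputable def epsVec (v : Vec) : Tensor :=
  Matrix.of fun i j => ∑ k, leviCivita i j k * v k

/-- `(ε · A) i = ∑ j k, ε i j k * A k j`, contracting neighbouring indices. -/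
noncomputable def epsTensor (A : Tensor) : Vec :=
  fun i => ∑ j, ∑ k, leviCivita i j k * A k j

/-- The scalar product `∑ i j, A i j * B i j` of two tensors. -/
def ddot (A B : Tensor) : ℝ := ∑ i, ∑ j, A i j * B i j

/-- The partial derivative `∂f/∂xⱼ` at `x`. -/
noncomputable def partialDeriv (j : Fin 3) (f : Space → ℝ) (x : Space) : ℝ :=
  fderiv ℝ f x (EuclideanSpace.single j 1)

/-- The gradient of a vector field, `(∇u) i j = ∂uⱼ/∂xᵢ`. -/
noncomputable def grad (u : Space → Vec) (x : Space) : Tensor :=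
  Matrix.of fun i j => partialDeriv i (fun y => u y j) x

/-- The divergence of a tensor field, `(div A) i = ∑ j, ∂A i j/∂xⱼ`. -/
noncomputable def div (A : Space → Tensor) (x : Space) : Vec :=
  fun i => ∑ j, partialDeriv j (fun y => A y i j) x

/-! ### Bodies, surface measure, outward normal -/

/-- Bounded open sets with Lipschitz boundary: near every boundary point, in suitable Cartesian
coordinates, the set is the region strictly below the graph of a Lipschitz function. -/
def IsLipschitzBody (B : Set Space) : Prop :=
  IsOpen B ∧ Bornology.IsBounded B ∧
    ∀ x ∈ frontier B, ∃ (R : Space ≃ₗᵢ[ℝ] Space) (f : EuclideanSpace ℝ (Fin 2) → ℝ) (K : NNReal),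
      LipschitzWith K f ∧ ∀ᶠ y in 𝓝 x, (y ∈ B ↔ R y 2 < f !₂[R y 0, R y 1])

/-- `ν` is the outward unit normal of `B` at `x`: a unit vector such that `B` coincides near `x`
with the half space `⟪y - x, ν⟫ < 0` up to arbitrarily thin cones around the tangent plane. -/
def IsOutwardNormal (B : Set Space) (x ν : Space) : Prop :=
  ‖ν‖ = 1 ∧ ∀ ε > 0, ∀ᶠ y in 𝓝 x,
    (inner ℝ (y - x) ν < -(ε * ‖y - x‖) → y ∈ B) ∧
    (ε * ‖y - x‖ < inner ℝ (y - x) ν → y ∉ B)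

open Classical in
/-- The field of outward unit normals of `B`; it is `0` at points that have no outward unit normal
(for a Lipschitz body the boundary points of this kind have surface measure zero). -/
noncomputable def outwardNormal (B : Set Space) (x : Space) : Vec :=
  if h : ∃ ν, IsOutwardNormal B x ν then WithLp.ofLp h.choose else 0

/-- The area measure on a subset `G` of the boundary of a body: the two-dimensional Hausdorff
measure, normalised to agree with Lebesgue measure on planes. -/
noncomputable def surfaceMeasure (G : Set Space) : Measure Space :=
  (μHE[2] : Measure Space).restrict G

/-- The measure `da dt` on `[t₀, t₁] × G`. -/
noncomputable def spaceTimeSurfaceMeasure (t₀ t₁ : ℝ) (G : Set Space) : Measure (ℝ × Space) :=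
  ((volume : Measure ℝ).restrict (Set.Icc t₀ t₁)).prod (surfaceMeasure G)

/-! ### Material -/

/-- The Lamé parameters `lam`, `mu` and the Cosserat elasticity parameters. -/
structure Moduli where
  lam : ℝ
  mu : ℝ
  alpha : ℝ
  beta : ℝ
  gamma : ℝ
  eps : ℝ

namespace Moduli

/-- The denominators of the reciprocal moduli do not vanish. -/
def Nondegenerate (m : Moduli) : Prop :=
  m.mu ≠ 0 ∧ m.alpha ≠ 0 ∧ m.gamma ≠ 0 ∧ m.eps ≠ 0 ∧
    m.lam + 2 * m.mu / 3 ≠ 0 ∧ m.beta + 2 * m.gamma / 3 ≠ 0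

/-- The reciprocal moduli `μ'`, `α'`, `γ'`, `ε'`, `λ'`, `β'`. -/
noncomputable def reciprocal (m : Moduli) : Moduli where
  mu := 1 / (4 * m.mu)
  alpha := 1 / (4 * m.alpha)
  gamma := 1 / (4 * m.gamma)
  eps := 1 / (4 * m.eps)
  lam := -m.lam / (6 * m.mu * (m.lam + 2 * m.mu / 3))
  beta := -m.beta / (6 * m.gamma * (m.beta + 2 * m.gamma / 3))

/-- The strain tensor that the inverse constitutive relation assigns to the stress tensor `σ`. -/
noncomputable def strainOfStress (m : Moduli) (σ : Tensor) : Tensor :=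
  (m.reciprocal.mu + m.reciprocal.alpha) • σ + (m.reciprocal.mu - m.reciprocal.alpha) • σᵀ
    + (m.reciprocal.lam * σ.trace) • (1 : Tensor)

/-- The torsion tensor that the inverse constitutive relation assigns to the couple stress
tensor `τ`. -/
noncomputable def torsionOfCouple (m : Moduli) (τ : Tensor) : Tensor :=
  (m.reciprocal.gamma + m.reciprocal.eps) • τ + (m.reciprocal.gamma - m.reciprocal.eps) • τᵀ
    + (m.reciprocal.beta * τ.trace) • (1 : Tensor)

/-- The stress energy density `Φ(σ, τ)`, where `τ` is the couple stress tensor. -/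
noncomputable def stressEnergyDensity (m : Moduli) (σ τ : Tensor) : ℝ :=
  (m.reciprocal.mu + m.reciprocal.alpha) / 2 * ddot σ σ
    + (m.reciprocal.mu - m.reciprocal.alpha) / 2 * ddot σ σᵀ
    + m.reciprocal.lam / 2 * (σ.trace * σ.trace)
    + (m.reciprocal.gamma + m.reciprocal.eps) / 2 * ddot τ τ
    + (m.reciprocal.gamma - m.reciprocal.eps) / 2 * ddot τ τᵀ
    + m.reciprocal.beta / 2 * (τ.trace * τ.trace)

end Moduli

/-! ### States -/

/-- A state `[u, φ, γ, χ, σ, μ]`: time dependent fields of displacement, rotation, strain, torsion,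
stress and couple stress. -/
structure State where
  disp : ℝ → Space → Vec
  rot : ℝ → Space → Vec
  strain : ℝ → Space → Tensor
  torsion : ℝ → Space → Tensor
  stress : ℝ → Space → Tensor
  couple : ℝ → Space → Tensor

/-- Tensor fields of class `C¹`. Fields of class `C¹` on `[t₀, t₁] × closure B` are represented by
`C¹` extensions to all of space-time; the values outside `[t₀, t₁] × closure B` play no role. -/
def TensorC1 (A : ℝ → Space → Tensor) : Prop :=
  ∀ i j, ContDiff ℝ 1 fun z : ℝ × Space => A z.1 z.2 i j

/-- Vector fields of class `C²`, with the same convention. -/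
def VecC2 (v : ℝ → Space → Vec) : Prop :=
  ∀ i, ContDiff ℝ 2 fun z : ℝ × Space => v z.1 z.2 i

namespace State

/-- The velocity field `∂u/∂t`. -/
noncomputable def velocity (s : State) (t : ℝ) (x : Space) : Vec :=
  deriv (fun τ => s.disp τ x) t

/-- The microrotation rate `∂φ/∂t`. -/
noncomputable def spin (s : State) (t : ℝ) (x : Space) : Vec :=
  deriv (fun τ => s.rot τ x) t

/-- The linear momentum `p = ρ ∂u/∂t`. -/
noncomputable def linMomentum (ρ : ℝ) (s : State) (t : ℝ) (x : Space) : Vec :=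
  ρ • s.velocity t x

/-- The angular momentum `q = J ∂φ/∂t`. -/
noncomputable def angMomentum (J : Tensor) (s : State) (t : ℝ) (x : Space) : Vec :=
  J *ᵥ s.spin t x

/-- The strain-displacement and torsion-rotation relations hold at time `t` and position `x`. -/
def KinematicAt (s : State) (t : ℝ) (x : Space) : Prop :=
  s.strain t x = (grad (s.disp t) x)ᵀ + epsVec (s.rot t x) ∧
  s.torsion t x = (grad (s.rot t) x)ᵀ

/-- Admissible states on `[t₀, t₁] × B`: sufficiently smooth up to the boundary and kinematically
admissible. -/
structure Admissible (B : Set Space) (t₀ t₁ : ℝ) (s : State) : Prop where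
  disp_smooth : VecC2 s.disp
  rot_smooth : VecC2 s.rot
  strain_smooth : TensorC1 s.strain
  torsion_smooth : TensorC1 s.torsion
  stress_smooth : TensorC1 s.stress
  couple_smooth : TensorC1 s.couple
  kinematic : ∀ t ∈ Set.Icc t₀ t₁, ∀ x ∈ B, s.KinematicAt t x

/-- The state `s + η δs`. -/
def perturb (s δs : State) (η : ℝ) : State where
  disp := s.disp + η • δs.disp
  rot := s.rot + η • δs.rot
  strain := s.strain + η • δs.strain
  torsion := s.torsion + η • δs.torsion
  stress := s.stress + η • δs.stress
  couple := s.couple + η • δs.couple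

/-- Admissible variations: admissible states whose displacement, rotation, linear momentum and
angular momentum vanish at the initial and at the terminal time. -/
structure IsVariation (B : Set Space) (t₀ t₁ ρ : ℝ) (J : Tensor) (δs : State) : Prop where
  admissible : δs.Admissible B t₀ t₁
  disp_ends : ∀ x ∈ B, δs.disp t₀ x = 0 ∧ δs.disp t₁ x = 0
  rot_ends : ∀ x ∈ B, δs.rot t₀ x = 0 ∧ δs.rot t₁ x = 0
  linMomentum_ends : ∀ x ∈ B, δs.linMomentum ρ t₀ x = 0 ∧ δs.linMomentum ρ t₁ x = 0
  angMomentum_ends : ∀ x ∈ B, δs.angMomentum J t₀ x = 0 ∧ δs.angMomentum J t₁ x = 0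

end State

/-! ### The problem data, the functional and the mixed problem -/

/-- The data of a mixed problem: the body, the part of its boundary with prescribed tractions, the
time interval, the material and inertia parameters, and the prescribed boundary fields. -/
structure Problem where
  body : Set Space
  tractionPart : Set Space
  t₀ : ℝ
  t₁ : ℝ
  moduli : Moduli
  ρ : ℝ
  J : Tensor
  u₀ : ℝ → Space → Vec
  φ₀ : ℝ → Space → Vec
  σ₀ : ℝ → Space → Vec
  μ₀ : ℝ → Space → Vec

namespace Problem

/-- The part of the boundary with prescribed displacements and rotations. -/
def dispPart (P : Problem) : Set Space := frontier P.body \ P.tractionPart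

/-- The standing assumptions: a bounded Lipschitz body, a measurable traction part of the boundary,
a nontrivial time interval, nondegenerate moduli, a symmetric rotatory inertia tensor, and boundary
data that are integrable over the parts where they are prescribed. -/
structure StandingAssumptions (P : Problem) : Prop where
  body_lipschitz : IsLipschitzBody P.body
  tractionPart_subset : P.tractionPart ⊆ frontier P.body
  tractionPart_measurable : MeasurableSet P.tractionPart
  time_lt : P.t₀ < P.t₁
  moduli_nondegenerate : P.moduli.Nondegenerate
  inertia_symm : P.J.IsSymm
  u₀_integrable : Integrable (fun z : ℝ × Space => P.u₀ z.1 z.2)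
    (spaceTimeSurfaceMeasure P.t₀ P.t₁ P.dispPart)
  φ₀_integrable : Integrable (fun z : ℝ × Space => P.φ₀ z.1 z.2)
    (spaceTimeSurfaceMeasure P.t₀ P.t₁ P.dispPart)
  σ₀_integrable : Integrable (fun z : ℝ × Space => P.σ₀ z.1 z.2)
    (spaceTimeSurfaceMeasure P.t₀ P.t₁ P.tractionPart)
  μ₀_integrable : Integrable (fun z : ℝ × Space => P.μ₀ z.1 z.2)
    (spaceTimeSurfaceMeasure P.t₀ P.t₁ P.tractionPart)

/-- The outward unit normal of the body. -/
noncomputable def normal (P : Problem) (x : Space) : Vec := outwardNormal P.body x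

/-- The stress energy `U_K` at time `t`. -/
noncomputable def stressEnergy (P : Problem) (s : State) (t : ℝ) : ℝ :=
  ∫ x in P.body, P.moduli.stressEnergyDensity (s.stress t x) (s.couple t x)

/-- The kinetic energy `T_C` at time `t`. -/
noncomputable def kineticEnergy (P : Problem) (s : State) (t : ℝ) : ℝ :=
  1 / 2 * ∫ x in P.body,
    (P.ρ * (s.velocity t x ⬝ᵥ s.velocity t x) + s.spin t x ⬝ᵥ (P.J *ᵥ s.spin t x))

/-- The work terms at time `t`. Since `p · ∂u/∂t + q · ∂φ/∂t` is twice the kinetic energy density,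
the kinetic contribution to the functional below, `-T_C` plus these two terms, amounts to `T_C`. -/
noncomputable def work (P : Problem) (s : State) (t : ℝ) : ℝ :=
  ∫ x in P.body,
    (-(ddot (s.stress t x) (s.strain t x) + ddot (s.couple t x) (s.torsion t x))
      + s.linMomentum P.ρ t x ⬝ᵥ s.velocity t x + s.angMomentum P.J t x ⬝ᵥ s.spin t x)

/-- The boundary term on the displacement part at time `t`. -/
noncomputable def dispBoundaryTerm (P : Problem) (s : State) (t : ℝ) : ℝ :=
  ∫ x, ((s.stress t x *ᵥ P.normal x) ⬝ᵥ (s.disp t x - P.u₀ t x)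
      + (s.couple t x *ᵥ P.normal x) ⬝ᵥ (s.rot t x - P.φ₀ t x)) ∂(surfaceMeasure P.dispPart)

/-- The boundary term on the traction part at time `t`. -/
noncomputable def tractionBoundaryTerm (P : Problem) (s : State) (t : ℝ) : ℝ :=
  ∫ x, (P.σ₀ t x ⬝ᵥ s.disp t x + P.μ₀ t x ⬝ᵥ s.rot t x) ∂(surfaceMeasure P.tractionPart)

/-- The functional `Θ`. -/
noncomputable def functional (P : Problem) (s : State) : ℝ :=
  (∫ t in P.t₀..P.t₁, (P.stressEnergy s t - P.kineticEnergy s t))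
    + (∫ t in P.t₀..P.t₁, P.work s t)
    + (∫ t in P.t₀..P.t₁, P.dispBoundaryTerm s t)
    + ∫ t in P.t₀..P.t₁, P.tractionBoundaryTerm s t

/-- `δΘ(s) = 0`: the derivative of `η ↦ Θ(s + η δs)` at `η = 0` exists and vanishes for every
admissible variation `δs`. -/
def Stationary (P : Problem) (s : State) : Prop :=
  ∀ δs : State, δs.IsVariation P.body P.t₀ P.t₁ P.ρ P.J →
    HasDerivAt (fun η : ℝ => P.functional (s.perturb δs η)) 0 0

/-- The balance laws, the inverse constitutive relations and the mixed boundary conditions. The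
boundary conditions hold almost everywhere for surface measure times Lebesgue measure in time. -/
structure IsSolution (P : Problem) (s : State) : Prop where
  linear_balance : ∀ t ∈ Set.Icc P.t₀ P.t₁, ∀ x ∈ P.body,
    div (s.stress t) x = deriv (fun τ => s.linMomentum P.ρ τ x) t
  angular_balance : ∀ t ∈ Set.Icc P.t₀ P.t₁, ∀ x ∈ P.body,
    epsTensor (s.stress t x) + div (s.couple t) x = deriv (fun τ => s.angMomentum P.J τ x) t
  strain_eq : ∀ t ∈ Set.Icc P.t₀ P.t₁, ∀ x ∈ P.body,
    s.strain t x = P.moduli.strainOfStress (s.stress t x)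
  torsion_eq : ∀ t ∈ Set.Icc P.t₀ P.t₁, ∀ x ∈ P.body,
    s.torsion t x = P.moduli.torsionOfCouple (s.couple t x)
  disp_boundary : ∀ᵐ z ∂(spaceTimeSurfaceMeasure P.t₀ P.t₁ P.dispPart),
    s.disp z.1 z.2 = P.u₀ z.1 z.2 ∧ s.rot z.1 z.2 = P.φ₀ z.1 z.2
  traction_boundary : ∀ᵐ z ∂(spaceTimeSurfaceMeasure P.t₀ P.t₁ P.tractionPart),
    s.stress z.1 z.2 *ᵥ P.normal z.2 = P.σ₀ z.1 z.2 ∧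
    s.couple z.1 z.2 *ᵥ P.normal z.2 = P.μ₀ z.1 z.2

end Problem

end Cosserat

/-!
Write `z = (t, x)`. Along a line `s + η δs` the functional is a quadratic polynomial in `η`, whose
linear coefficient is `firstVariation` (`hasDerivAt_functional`; the symmetry of the inertia tensor
makes the kinetic term symmetric). Integration by parts in time, where `δu` and `δφ` vanish at the
ends, and the divergence theorem in space turn it into the weak form (`firstVariation_eq`)

`∫∫_B [(E(σ) - γ) : δσ + (X(μ) - χ) : δμ + (div σ - ∂ₜp) · δu + (ε · σ + div μ - ∂ₜq) · δφ]`
`+ ∫∫_{G₁} [δσ n · (u - u₀) + δμ n · (φ - φ₀)] + ∫∫_{G₂} [(σ₀ - σ n) · δu + (μ₀ - μ n) · δφ]`,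

with `E` and `X` the inverse constitutive maps. A solution makes every term vanish. Conversely, the
displacement, rotation, stress and couple stress of a variation are independent of each other, since
its strain and torsion are determined by kinematics. Testing with `ψ` times constants, first with
`ψ` supported inside the body and then with `ψ` unrestricted in space, the fundamental lemma of the
calculus of variations gives the field equations and afterwards the boundary conditions. For the
displacement conditions one obtains `(u - u₀) ⊗ n = 0`, which suffices because `n` is a unit vector
almost everywhere.

The analytic ingredient is the divergence theorem on Lipschitz bodies for the two-dimensional
Hausdorff measure (`IsLipschitzBody.setIntegral_partialDeriv`). It rests on three facts. The area
formula for Lipschitz graphs (`IsGraphParam.comap_eq_withDensity`) identifies the surface measure in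
a chart. Below a graph the theorem holds in graph coordinates (`setIntegral_fderiv_subgraph`): after
flattening the graph, tangential derivatives integrate to zero and the vertical derivative
integrates to the boundary value. At points where the height function is differentiable, that is
almost everywhere by Rademacher's theorem, `(-∇f, 1)/√(1 + |∇f|²)` is the outward normal
(`isOutwardNormal_graphNormal`). A partition of unity then passes from charts to the body.
-/

namespace Cosserat

open scoped NNReal ENNReal
open Set

/-! ### The area formula for Lipschitz graphs -/

/-- The plane over which Lipschitz graphs in `Space` are parametrised. -/
abbrev Plane := EuclideanSpace ℝ (Fin 2)

/-- The area density of a graph whose height function has derivative `a`. -/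
noncomputable def graphJacobian (a : Plane →L[ℝ] ℝ) : ℝ := √(1 + ‖a‖ ^ 2)

lemma one_le_graphJacobian (a : Plane →L[ℝ] ℝ) : 1 ≤ graphJacobian a := by
  apply Real.one_le_sqrt.2; nlinarith [sq_nonneg ‖a‖]

lemma graphJacobian_pos (a : Plane →L[ℝ] ℝ) : 0 < graphJacobian a :=
  zero_lt_one.trans_le (one_le_graphJacobian a)

lemma graphJacobian_sq (a : Plane →L[ℝ] ℝ) : graphJacobian a ^ 2 = 1 + ‖a‖ ^ 2 :=
  Real.sq_sqrt (by positivity)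

lemma continuous_graphJacobian : Continuous graphJacobian := by
  unfold graphJacobian; fun_prop

lemma graphJacobian_le_add (a b : Plane →L[ℝ] ℝ) :
    graphJacobian a ≤ graphJacobian b + ‖a - b‖ := by
  have h1 : ‖a‖ ≤ ‖b‖ + ‖a - b‖ := by
    calc ‖a‖ = ‖b + (a - b)‖ := by congr 1; abel
      _ ≤ _ := norm_add_le _ _
  have hb : ‖b‖ ≤ graphJacobian b := Real.le_sqrt_of_sq_le (by linarith)
  apply Real.sqrt_le_iff.2
  refine ⟨add_nonneg (graphJacobian_pos b).le (norm_nonneg _), ?_⟩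
  have := graphJacobian_sq b
  nlinarith [norm_nonneg a, norm_nonneg b, norm_nonneg (a - b)]

lemma graphJacobian_le_mul {a b : Plane →L[ℝ] ℝ} {ε : ℝ} (h : ‖a - b‖ ≤ ε) :
    graphJacobian a ≤ (1 + ε) * graphJacobian b := by
  have := graphJacobian_le_add a b
  nlinarith [one_le_graphJacobian b, norm_nonneg (a - b)]

/-- A linear graph is isometric to the plane carrying the metric `‖w‖² + (a w)²`. This metric is
the pull-back of the Euclidean one by a linear map of determinant `graphJacobian a`. -/
lemma exists_linearMap_norm_sq_eq (a : Plane →L[ℝ] ℝ) :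
    ∃ T : Plane →ₗ[ℝ] Plane, (∀ w, ‖T w‖ ^ 2 = ‖w‖ ^ 2 + (a w) ^ 2) ∧
      LinearMap.det T = graphJacobian a := by
  obtain ⟨v, rfl⟩ := (InnerProductSpace.toDual ℝ Plane).surjective a
  set J := graphJacobian (InnerProductSpace.toDual ℝ Plane v) with hJ
  have hJ2 : J ^ 2 = 1 + ‖v‖ ^ 2 := by rw [hJ, graphJacobian_sq]; simp
  have hJ1 : 0 < J := graphJacobian_pos _
  -- `T w = w + c ⟪v, w⟫ v` with `1 + c ‖v‖² = J`; since `J² = 1 + ‖v‖²`, this is `c = 1 / (1 + J)`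
  refine ⟨LinearMap.transvection (InnerProductSpace.toDual ℝ Plane v).toLinearMap
    ((1 / (1 + J)) • v), fun w => ?_, ?_⟩
  · simp only [LinearMap.transvection.apply]
    rw [norm_add_sq_real, norm_smul, norm_smul, inner_smul_right, inner_smul_right]
    simp only [ContinuousLinearMap.coe_coe, InnerProductSpace.toDual_apply_apply, Real.norm_eq_abs,
      mul_pow, sq_abs]
    rw [real_inner_comm v w, show ‖v‖ ^ 2 = J ^ 2 - 1 by linarith]
    field_simp
    ring
  · rw [LinearMap.transvection.det]
    simp only [map_smul, ContinuousLinearMap.coe_coe, InnerProductSpace.toDual_apply_apply,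
      real_inner_self_eq_norm_sq, smul_eq_mul]
    rw [show ‖v‖ ^ 2 = J ^ 2 - 1 by linarith]
    field_simp
    ring

lemma edist_le_coe_mul_of_dist_le {Y Z : Type*} [PseudoMetricSpace Y] [PseudoMetricSpace Z]
    {p q : Y} {r s : Z} {C : ℝ≥0} (h : dist p q ≤ C * dist r s) :
    edist p q ≤ (C : ℝ≥0∞) * edist r s := by
  rw [edist_nndist, edist_nndist, ← ENNReal.coe_mul, ENNReal.coe_le_coe, ← NNReal.coe_le_coe]
  simpa using h

section Comparison

variable {α X Y : Type*}
variable [EMetricSpace X] [MeasurableSpace X] [BorelSpace X]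
variable [EMetricSpace Y] [MeasurableSpace Y] [BorelSpace Y]

lemma euclideanHausdorffMeasure_image_le_of_edist_le {g : α → X} {h : α → Y} {S : Set α} {C : ℝ≥0}
    (d : ℕ) (H : ∀ x ∈ S, ∀ y ∈ S, edist (g x) (g y) ≤ C * edist (h x) (h y)) :
    (μHE[d] : Measure X) (g '' S) ≤ (C : ℝ≥0∞) ^ d * (μHE[d] : Measure Y) (h '' S) := by
  rcases S.eq_empty_or_nonempty with rfl | ⟨x₀, hx₀⟩
  · simp
  have : Nonempty α := ⟨x₀⟩
  set φ := fun y => g (Function.invFunOn h S y)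
  have hφ : ∀ x ∈ S, φ (h x) = g x := by
    intro x hx
    have hm := Function.invFunOn_mem (f := h) (s := S) ⟨x, hx, rfl⟩
    have he := Function.invFunOn_eq (f := h) (s := S) ⟨x, hx, rfl⟩
    have := H _ hm x hx
    rw [he, edist_self, mul_zero] at this
    exact edist_le_zero.1 this
  have hL : LipschitzOnWith C φ (h '' S) := by
    rintro _ ⟨x, hx, rfl⟩ _ ⟨y, hy, rfl⟩
    rw [hφ x hx, hφ y hy]
    exact H x hx y hy
  have him : φ '' (h '' S) = g '' S := by
    rw [image_image]; exact image_congr hφ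
  have := hL.hausdorffMeasure_image_le (d := (d : ℝ)) (by positivity)
  rw [him, ENNReal.rpow_natCast] at this
  simp only [Measure.euclideanHausdorffMeasure_def, Measure.smul_apply, ENNReal.smul_def,
    smul_eq_mul]
  calc _ ≤ _ := mul_le_mul_right this _
    _ = _ := by ring

end Comparison

section Area

variable {X : Type*} [MetricSpace X]

/-- `G` parametrises a copy of the graph of `f`: distances of image points are those of the points
`(x, f x)`. -/
def IsGraphParam (f : Plane → ℝ) (G : Plane → X) : Prop :=
  ∀ x y, dist (G x) (G y) ^ 2 = dist x y ^ 2 + (f x - f y) ^ 2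

variable {f : Plane → ℝ} {G : Plane → X} {K : ℝ≥0}

lemma IsGraphParam.dist_le (hG : IsGraphParam f G) (x y : Plane) : dist x y ≤ dist (G x) (G y) := by
  apply (pow_le_pow_iff_left₀ dist_nonneg dist_nonneg two_ne_zero).1
  rw [hG]; nlinarith [sq_nonneg (f x - f y)]

lemma IsGraphParam.antilipschitz (hG : IsGraphParam f G) : AntilipschitzWith 1 G :=
  AntilipschitzWith.of_le_mul_dist fun x y => by simpa using hG.dist_le x y

lemma IsGraphParam.lipschitz (hG : IsGraphParam f G) (hf : LipschitzWith K f) :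
    LipschitzWith (1 + K) G := by
  refine LipschitzWith.of_dist_le_mul fun x y => ?_
  apply (pow_le_pow_iff_left₀ dist_nonneg (by positivity) two_ne_zero).1
  have h1 := hf.dist_le_mul x y
  rw [Real.dist_eq] at h1
  have h2 : (f x - f y) ^ 2 ≤ (K * dist x y) ^ 2 := by
    rw [← sq_abs]; gcongr
  rw [hG, mul_pow]
  push_cast
  nlinarith [dist_nonneg (x := x) (y := y), K.coe_nonneg, sq_nonneg (dist x y),
    mul_nonneg K.coe_nonneg (sq_nonneg (dist x y))]

lemma IsGraphParam.isClosedEmbedding (hG : IsGraphParam f G) (hf : LipschitzWith K f) :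
    IsClosedEmbedding G :=
  hG.antilipschitz.isClosedEmbedding (hG.lipschitz hf).uniformContinuous

variable [MeasurableSpace X] [BorelSpace X]

/-- On a set where `f` is nearly linear, the graph is nearly isometric to a linear one. -/
lemma IsGraphParam.measure_image_comparison (hG : IsGraphParam f G) {a : Plane →L[ℝ] ℝ}
    {S : Set Plane} {ε : ℝ≥0} (ha : ApproximatesLinearOn f a S ε) :
    (μHE[2] : Measure X) (G '' S) ≤
        (1 + ε : ℝ≥0) ^ 2 * (ENNReal.ofReal (graphJacobian a) * volume S) ∧
    ENNReal.ofReal (graphJacobian a) * volume S ≤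
        (1 + ε : ℝ≥0) ^ 2 * (μHE[2] : Measure X) (G '' S) := by
  obtain ⟨T, hT, hdet⟩ := exists_linearMap_norm_sq_eq a
  have hvol : (μHE[2] : Measure Plane) (T '' S) = ENNReal.ofReal (graphJacobian a) * volume S := by
    rw [EuclideanSpace.euclideanHausdorffMeasure_eq_volume, Measure.addHaar_image_linearMap, hdet,
      abs_of_pos (graphJacobian_pos a)]
  have key : ∀ x ∈ S, ∀ y ∈ S, |dist (G x) (G y) - dist (T x) (T y)| ≤ ε * dist x y := by
    intro x hx y hy
    have e1 : dist (G x) (G y) = ‖WithLp.toLp 2 (x - y, f x - f y)‖ := by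
      rw [WithLp.prod_norm_eq_of_L2, ← Real.sqrt_sq dist_nonneg, hG]
      simp [dist_eq_norm]
    have e2 : dist (T x) (T y) = ‖WithLp.toLp 2 (x - y, a (x - y))‖ := by
      rw [WithLp.prod_norm_eq_of_L2, dist_eq_norm, ← map_sub, ← Real.sqrt_sq (norm_nonneg (T _)),
        hT]
      simp
    rw [e1, e2]
    refine (abs_norm_sub_norm_le _ _).trans ?_
    rw [← WithLp.toLp_sub, WithLp.prod_norm_eq_of_L2]
    simpa [dist_eq_norm, Real.sqrt_sq_eq_abs] using ha x hx y hy
  have hTd : ∀ x y, dist x y ≤ dist (T x) (T y) := by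
    intro x y
    apply (pow_le_pow_iff_left₀ dist_nonneg dist_nonneg two_ne_zero).1
    rw [dist_eq_norm (T x), ← map_sub, hT, dist_eq_norm]
    nlinarith [sq_nonneg (a (x - y))]
  rw [← hvol]
  constructor
  · refine euclideanHausdorffMeasure_image_le_of_edist_le 2 fun x hx y hy =>
      edist_le_coe_mul_of_dist_le ?_
    push_cast
    have := (abs_le.1 (key x hx y hy)).2
    nlinarith [hTd x y, mul_le_mul_of_nonneg_left (hTd x y) ε.coe_nonneg]
  · refine euclideanHausdorffMeasure_image_le_of_edist_le 2 fun x hx y hy =>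
      edist_le_coe_mul_of_dist_le ?_
    push_cast
    have := (abs_le.1 (key x hx y hy)).1
    nlinarith [hG.dist_le x y, mul_le_mul_of_nonneg_left (hG.dist_le x y) ε.coe_nonneg]

/-- The area formula for Lipschitz graphs: surface measure pulls back to Lebesgue measure with
density `√(1 + ‖f'‖²)`. The two measures are compared on the countably many pieces where `f` is
within `ε` of a linear function, and `ε` tends to zero. -/
theorem IsGraphParam.comap_eq_withDensity (hG : IsGraphParam f G) (hf : LipschitzWith K f) :
    (μHE[2] : Measure X).comap G =
      (volume : Measure Plane).withDensity
        fun x => ENNReal.ofReal (graphJacobian (fderiv ℝ f x)) := by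
  have hemb := (hG.isClosedEmbedding hf).measurableEmbedding
  set m₁ := (μHE[2] : Measure X).comap G with hm₁
  set m₂ := (volume : Measure Plane).withDensity
        fun x => ENNReal.ofReal (graphJacobian (fderiv ℝ f x)) with hm₂
  have hm₁_apply : ∀ S, m₁ S = (μHE[2] : Measure X) (G '' S) := fun S => hemb.comap_apply _ _
  set D := {x | DifferentiableAt ℝ f x}
  have hD : MeasurableSet D := measurableSet_of_differentiableAt ℝ f
  have hDc : volume Dᶜ = 0 := hf.ae_differentiableAt
  have h₂c : m₂ Dᶜ = 0 := withDensity_absolutelyContinuous _ _ hDc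
  have h₁c : m₁ Dᶜ = 0 := by
    have h : (μHE[2] : Measure X) (G '' Dᶜ) ≤
        ((1 + K : ℝ≥0) : ℝ≥0∞) ^ 2 * (μHE[2] : Measure Plane) (id '' Dᶜ) :=
      euclideanHausdorffMeasure_image_le_of_edist_le 2 fun x _ y _ => (hG.lipschitz hf) x y
    rw [image_id, EuclideanSpace.euclideanHausdorffMeasure_eq_volume, hDc, mul_zero] at h
    rw [hm₁_apply]; exact le_antisymm h bot_le
  -- the comparison at precision `ε`
  have main : ∀ ε : ℝ≥0, ε ≠ 0 → ∀ M, MeasurableSet M →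
      m₁ M ≤ ((1 + ε : ℝ≥0) : ℝ≥0∞) ^ 3 * m₂ M ∧ m₂ M ≤ ((1 + ε : ℝ≥0) : ℝ≥0∞) ^ 3 * m₁ M := by
    intro ε hε M hM
    obtain ⟨t, A, t_disj, t_meas, t_cover, t_approx, -⟩ :=
      exists_partition_approximatesLinearOn_of_hasFDerivWithinAt f D (fderiv ℝ f)
        (fun x hx => (DifferentiableAt.hasFDerivAt hx).hasFDerivWithinAt) (fun _ => ε) fun _ => hε
    set S : ℕ → Set Plane := fun n => M ∩ (D ∩ t n) with hS
    have hSm : ∀ n, MeasurableSet (S n) := fun n => hM.inter (hD.inter (t_meas n))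
    have hSd : Pairwise (Function.onFun Disjoint S) := fun i j hij =>
      (t_disj hij).mono (fun x hx => hx.2.2) (fun x hx => hx.2.2)
    have hMS : M ∩ D = ⋃ n, S n := by
      ext x
      simp only [hS, mem_inter_iff, mem_iUnion]
      constructor
      · rintro ⟨h1, h2⟩
        obtain ⟨n, hn⟩ := mem_iUnion.1 (t_cover h2)
        exact ⟨n, h1, h2, hn⟩
      · rintro ⟨n, h1, h2, -⟩; exact ⟨h1, h2⟩
    have hsum : ∀ m : Measure Plane, m Dᶜ = 0 → m M = ∑' n, m (S n) := by
      intro m hm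
      rw [← measure_iUnion hSd hSm, ← hMS, measure_inter_conull hm]
    have hclose : ∀ n, ∀ᵐ x ∂volume.restrict (S n), ‖fderiv ℝ f x - A n‖ ≤ ε := by
      intro n
      set e : Plane := EuclideanSpace.single 0 1 with he
      have hnorm : ∀ b : Plane →L[ℝ] ℝ, ‖b.smulRight e‖ = ‖b‖ := by
        intro b
        rw [ContinuousLinearMap.norm_smulRight_apply, he, PiLp.norm_single]; simp
      have happ : ApproximatesLinearOn (fun x => f x • e) ((A n).smulRight e) (S n) ε := by
        intro x hx y hy
        have := t_approx n x hx.2 y hy.2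
        simp only [ContinuousLinearMap.smulRight_apply, ← sub_smul, norm_smul]
        rw [he, PiLp.norm_single]; simpa using this
      have := happ.norm_fderiv_sub_le volume (hSm n) (fun x => (fderiv ℝ f x).smulRight e)
        (fun x hx => ((DifferentiableAt.hasFDerivAt hx.2.1).smul_const e).hasFDerivWithinAt)
      filter_upwards [this] with x hx
      rw [← NNReal.coe_le_coe, coe_nnnorm] at hx
      rw [← hnorm]
      have hsub : (fderiv ℝ f x - A n).smulRight e
          = (fderiv ℝ f x).smulRight e - (A n).smulRight e := by
        ext w : 1
        simp [sub_smul]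
      rwa [hsub]
    have hofReal : ∀ {a b : Plane →L[ℝ] ℝ}, ‖a - b‖ ≤ ε → ENNReal.ofReal (graphJacobian a) ≤
        ((1 + ε : ℝ≥0) : ℝ≥0∞) * ENNReal.ofReal (graphJacobian b) := by
      intro a b h
      rw [← ENNReal.ofReal_coe_nnreal, ← ENNReal.ofReal_mul (by positivity)]
      exact ENNReal.ofReal_le_ofReal (by simpa using graphJacobian_le_mul h)
    have hpiece : ∀ n, m₁ (S n) ≤ ((1 + ε : ℝ≥0) : ℝ≥0∞) ^ 3 * m₂ (S n) ∧
        m₂ (S n) ≤ ((1 + ε : ℝ≥0) : ℝ≥0∞) ^ 3 * m₁ (S n) := by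
      intro n
      obtain ⟨c1, c2⟩ := hG.measure_image_comparison
        ((t_approx n).mono_set (inter_subset_right : S n ⊆ D ∩ t n))
      rw [← hm₁_apply] at c1 c2
      have d1 : ENNReal.ofReal (graphJacobian (A n)) * volume (S n) ≤
          ((1 + ε : ℝ≥0) : ℝ≥0∞) * m₂ (S n) := by
        rw [hm₂, withDensity_apply _ (hSm n), ← lintegral_const_mul' _ _ ENNReal.coe_ne_top,
          ← setLIntegral_const]
        refine lintegral_mono_ae ?_
        filter_upwards [hclose n] with x hx
        exact hofReal (by rwa [norm_sub_rev])
      have d2 : m₂ (S n) ≤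
          ((1 + ε : ℝ≥0) : ℝ≥0∞) * (ENNReal.ofReal (graphJacobian (A n)) * volume (S n)) := by
        rw [hm₂, withDensity_apply _ (hSm n), ← mul_assoc, ← setLIntegral_const]
        refine lintegral_mono_ae ?_
        filter_upwards [hclose n] with x hx
        exact hofReal hx
      constructor
      · calc _ ≤ _ := c1
          _ ≤ _ := mul_le_mul_right d1 _
          _ = _ := by ring
      · calc _ ≤ _ := d2
          _ ≤ _ := mul_le_mul_right c2 _
          _ = _ := by ring
    rw [hsum m₁ h₁c, hsum m₂ h₂c, ← ENNReal.tsum_mul_left, ← ENNReal.tsum_mul_left]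
    exact ⟨ENNReal.tsum_le_tsum fun n => (hpiece n).1, ENNReal.tsum_le_tsum fun n => (hpiece n).2⟩
  have lim : ∀ p q : ℝ≥0∞, (∀ ε : ℝ≥0, ε ≠ 0 → p ≤ ((1 + ε : ℝ≥0) : ℝ≥0∞) ^ 3 * q) → p ≤ q := by
    intro p q h
    have hc : Filter.Tendsto (fun ε : ℝ≥0 => ((1 + ε : ℝ≥0) : ℝ≥0∞) ^ 3 * q) (𝓝[≠] 0)
        (𝓝 (((1 + 0 : ℝ≥0) : ℝ≥0∞) ^ 3 * q)) := by
      refine Filter.Tendsto.mono_left ?_ nhdsWithin_le_nhds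
      refine ENNReal.Tendsto.mul_const ?_ (Or.inl (by simp))
      refine ENNReal.Tendsto.pow ?_
      exact ENNReal.tendsto_coe.2 (by
        have : Continuous fun ε : ℝ≥0 => 1 + ε := by fun_prop
        exact this.tendsto 0)
    simp only [add_zero, ENNReal.coe_one, one_pow, one_mul] at hc
    exact ge_of_tendsto hc (Filter.eventually_of_mem self_mem_nhdsWithin h)
  ext M hM
  exact le_antisymm (lim _ _ fun ε hε => (main ε hε M hM).1)
    (lim _ _ fun ε hε => (main ε hε M hM).2)

end Area

/-! ### The divergence theorem below a Lipschitz graph -/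

/-- `Space` as the product of `Plane` and a vertical axis: `(x, s)` goes to the point above `x` at
height `s`. -/
noncomputable def cylEquiv : (Plane × ℝ) ≃L[ℝ] Space :=
  LinearEquiv.toContinuousLinearEquiv
    { toFun := fun z => !₂[z.1 0, z.1 1, z.2]
      invFun := fun y => (!₂[y 0, y 1], y 2)
      map_add' := fun z w => by ext i; fin_cases i <;> simp
      map_smul' := fun c z => by ext i; fin_cases i <;> simp
      left_inv := fun z => by
        ext i
        · fin_cases i <;> simp
        · simp
      right_inv := fun y => by ext i; fin_cases i <;> simp }

lemma cylEquiv_apply (z : Plane × ℝ) : cylEquiv z = !₂[z.1 0, z.1 1, z.2] := rfl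

lemma measurePreserving_cylEquiv : MeasurePreserving cylEquiv volume volume := by
  have h1 : MeasurePreserving (fun z : Plane × ℝ => (z.2, WithLp.ofLp z.1)) volume
      ((volume : Measure ℝ).prod (volume : Measure (Fin 2 → ℝ))) :=
    ((MeasurePreserving.id (volume : Measure ℝ)).prod
      (PiLp.volume_preserving_ofLp (Fin 2))).comp Measure.measurePreserving_swap
  have h2 := (volume_preserving_piFinSuccAbove (fun _ : Fin 3 => ℝ) 2).symm
  have h3 := PiLp.volume_preserving_toLp (Fin 3)
  have heq : ⇑cylEquiv = WithLp.toLp 2 ∘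
      (MeasurableEquiv.piFinSuccAbove (fun _ : Fin 3 => ℝ) 2).symm ∘
      fun z : Plane × ℝ => (z.2, WithLp.ofLp z.1) := by
    funext z
    ext i
    fin_cases i <;> rfl
  rw [heq]
  exact h3.comp (h2.comp h1)

/-- The point of the graph of `f` above `x`. -/
noncomputable def graphMap (f : Plane → ℝ) (x : Plane) : Space := cylEquiv (x, f x)

lemma norm_cylEquiv_sq (z : Plane × ℝ) : ‖cylEquiv z‖ ^ 2 = ‖z.1‖ ^ 2 + z.2 ^ 2 := by
  rw [cylEquiv_apply]
  simp [EuclideanSpace.norm_sq_eq, Fin.sum_univ_succ]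
  ring

lemma isGraphParam_graphMap (f : Plane → ℝ) : IsGraphParam f (graphMap f) := by
  intro x y
  rw [dist_eq_norm, graphMap, graphMap, ← map_sub, norm_cylEquiv_sq, dist_eq_norm]
  rfl

/-- The open region strictly below the graph of `f`. -/
def subgraph (f : Plane → ℝ) : Set Space := {y | y 2 < f !₂[y 0, y 1]}

lemma cylEquiv_mem_subgraph (f : Plane → ℝ) (z : Plane × ℝ) :
    cylEquiv z ∈ subgraph f ↔ z.2 < f z.1 := by
  have : (!₂[z.1 0, z.1 1] : Plane) = z.1 := by ext i; fin_cases i <;> rfl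
  show z.2 < f !₂[z.1 0, z.1 1] ↔ _
  rw [this]

/-- The shear that flattens the graph of `f` to the plane `s = 0`. -/
def shear {f : Plane → ℝ} (hf : Continuous f) : (Plane × ℝ) ≃ₜ (Plane × ℝ) where
  toFun z := (z.1, f z.1 + z.2)
  invFun z := (z.1, z.2 - f z.1)
  left_inv z := by simp
  right_inv z := by simp
  continuous_toFun := by fun_prop
  continuous_invFun := by fun_prop

lemma measurePreserving_shear {f : Plane → ℝ} (hf : Continuous f) :
    MeasurePreserving (shear hf) volume volume := by
  refine (MeasurePreserving.id (volume : Measure Plane)).skew_product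
    (g := fun x s => f x + s) (by fun_prop) ?_
  exact Filter.Eventually.of_forall fun x => (measurePreserving_add_left volume (f x)).map_eq

/-- Integrals over the region below a graph, in flattened coordinates. -/
lemma setIntegral_subgraph {f : Plane → ℝ} (hf : Continuous f) (g : Space → ℝ) :
    ∫ y in subgraph f, g y =
      ∫ z in (univ ×ˢ Iio 0 : Set (Plane × ℝ)), g (cylEquiv (shear hf z)) := by
  have hmp := measurePreserving_cylEquiv.comp (measurePreserving_shear hf)
  have hemb : MeasurableEmbedding (cylEquiv ∘ shear hf) :=
    ((shear hf).trans cylEquiv.toHomeomorph).measurableEmbedding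
  rw [← hmp.setIntegral_preimage_emb hemb g]
  congr 2
  ext z
  simp only [mem_preimage, Function.comp_apply, cylEquiv_mem_subgraph, shear]
  simp

lemma integrable_comp_shear {f : Plane → ℝ} (hf : Continuous f) {g : Space → ℝ}
    (hg : Continuous g) (hgc : HasCompactSupport g) :
    Integrable (fun z => g (cylEquiv (shear hf z))) := by
  refine Continuous.integrable_of_hasCompactSupport ?_ ?_
  · exact hg.comp (cylEquiv.continuous.comp (shear hf).continuous)
  · exact hgc.comp_homeomorph ((shear hf).trans cylEquiv.toHomeomorph)

lemma norm_fderiv_apply_le_of_lipschitz {f : Plane → ℝ} {K : ℝ≥0} (hf : LipschitzWith K f)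
    (x v : Plane) :
    ‖fderiv ℝ f x v‖ ≤ K * ‖v‖ :=
  ((fderiv ℝ f x).le_opNorm v).trans (by gcongr; exact norm_fderiv_le_of_lipschitz ℝ hf)

lemma integral_lineDeriv_eq_zero {E : Type*} [NormedAddCommGroup E] [NormedSpace ℝ E]
    [FiniteDimensional ℝ E] [MeasurableSpace E] [BorelSpace E] {μ : Measure E} [μ.IsAddHaarMeasure]
    {g : E → ℝ} {C : ℝ≥0} (hg : LipschitzWith C g) (hc : HasCompactSupport g) (v : E) :
    ∫ x, lineDeriv ℝ g x v ∂μ = 0 := by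
  have h := (LipschitzWith.const (α := E) (1 : ℝ)).integral_lineDeriv_mul_eq (μ := μ) hg hc (-v)
  simpa [lineDeriv] using h.symm

/-- The part of the derivative of `h` tangential to the graph integrates to zero over every
translate of the graph, since it is the derivative of a compactly supported Lipschitz function. -/
lemma integral_tangential_eq_zero {f : Plane → ℝ} {K : ℝ≥0} (hf : LipschitzWith K f)
    {h : Space → ℝ} (hh : ContDiff ℝ 1 h) (hc : HasCompactSupport h) (v : Plane) (s : ℝ) :
    ∫ x, fderiv ℝ h (cylEquiv (x, f x + s)) (cylEquiv (v, fderiv ℝ f x v)) = 0 := by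
  obtain ⟨L, hL⟩ := hh.lipschitzWith_of_hasCompactSupport hc one_ne_zero
  have hp : LipschitzWith (1 + K) (fun x => cylEquiv (x, f x + s)) :=
    (show IsGraphParam f (fun x => cylEquiv (x, f x + s)) by
      intro x y
      rw [dist_eq_norm, ← map_sub, norm_cylEquiv_sq, dist_eq_norm]
      simp).lipschitz hf
  have hg : LipschitzWith (L * (1 + K)) (fun x => h (cylEquiv (x, f x + s))) := hL.comp hp
  have hgc : HasCompactSupport (fun x => h (cylEquiv (x, f x + s))) := by
    refine hc.comp_isClosedEmbedding (g := fun x => cylEquiv (x, f x + s)) ?_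
    exact (show IsGraphParam f (fun x => cylEquiv (x, f x + s)) by
      intro x y
      rw [dist_eq_norm, ← map_sub, norm_cylEquiv_sq, dist_eq_norm]
      simp).isClosedEmbedding hf
  rw [← integral_lineDeriv_eq_zero (μ := volume) hg hgc v]
  refine integral_congr_ae ?_
  filter_upwards [hf.ae_differentiableAt] with x hx
  have e1 : HasFDerivAt (fun x => cylEquiv (x, f x + s))
      ((cylEquiv : (Plane × ℝ) →L[ℝ] Space).comp ((ContinuousLinearMap.id ℝ Plane).prod
        (fderiv ℝ f x))) x :=
    cylEquiv.hasFDerivAt.comp x ((hasFDerivAt_id x).prodMk (hx.hasFDerivAt.add_const s))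
  have e2 := ((hh.differentiable one_ne_zero) (cylEquiv (x, f x + s))).hasFDerivAt.comp x e1
  exact (e2.hasLineDerivAt v).lineDeriv.symm

/-- The derivative of `h` along the vertical integrates to the boundary value. -/
lemma integral_vertical {h : Space → ℝ} (hh : ContDiff ℝ 1 h) (hc : HasCompactSupport h)
    (x : Plane) (c : ℝ) :
    ∫ s in Iio (0 : ℝ), fderiv ℝ h (cylEquiv (x, c + s)) (cylEquiv (0, 1)) =
      h (cylEquiv (x, c)) := by
  have hd : ∀ s : ℝ, HasDerivAt (fun s : ℝ => h (cylEquiv (x, c + s)))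
      (fderiv ℝ h (cylEquiv (x, c + s)) (cylEquiv (0, 1))) s := by
    intro s
    have e1 : HasDerivAt (fun s : ℝ => cylEquiv (x, c + s)) (cylEquiv (0, 1)) s :=
      cylEquiv.hasFDerivAt.comp_hasDerivAt s
        ((hasDerivAt_const s x).prodMk ((hasDerivAt_id s).const_add c))
    exact ((hh.differentiable one_ne_zero) _).hasFDerivAt.comp_hasDerivAt s e1
  have hemb : IsClosedEmbedding (fun s : ℝ => cylEquiv (x, c + s)) := by
    refine (Isometry.of_dist_eq fun s t => ?_).isClosedEmbedding
    rw [dist_eq_norm, ← map_sub, ← Real.sqrt_sq (norm_nonneg (cylEquiv _)), norm_cylEquiv_sq]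
    simp [Real.sqrt_sq_eq_abs, Real.dist_eq]
  have hgc : HasCompactSupport (fun s : ℝ => h (cylEquiv (x, c + s))) :=
    hc.comp_isClosedEmbedding hemb
  rw [← integral_Iic_eq_integral_Iio]
  have := integral_Iic_of_hasDerivAt_of_tendsto' (a := 0) (fun s _ => hd s) ?_
    (show Filter.Tendsto (fun s : ℝ => h (cylEquiv (x, c + s))) Filter.atBot (𝓝 0) from ?_)
  · simpa using this
  · refine Integrable.integrableOn (Continuous.integrable_of_hasCompactSupport ?_ ?_)
    · have := hh.continuous_fderiv one_ne_zero
      fun_prop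
    · have := (hc.fderiv ℝ).comp_isClosedEmbedding hemb
      exact this.mono (fun s hs h0 => hs (by
        simp only [Function.comp_apply] at h0; simp [h0]))
  · rw [hasCompactSupport_iff_eventuallyEq] at hgc
    refine Filter.Tendsto.congr' ?_ tendsto_const_nhds
    have : Filter.atBot ≤ Filter.coclosedCompact ℝ := by
      rw [Filter.coclosedCompact_eq_cocompact]; exact atBot_le_cocompact
    filter_upwards [this hgc] with s hs
    exact hs.symm

/-- The divergence theorem below the graph of a Lipschitz function, in graph coordinates:
`(-∇f, 1)` is an upward normal whose length is the area density. -/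
theorem setIntegral_fderiv_subgraph {f : Plane → ℝ} {K : ℝ≥0} (hf : LipschitzWith K f)
    {h : Space → ℝ} (hh : ContDiff ℝ 1 h) (hc : HasCompactSupport h) (v : Plane × ℝ) :
    ∫ y in subgraph f, fderiv ℝ h y (cylEquiv v) =
      ∫ x, h (graphMap f x) * (v.2 - fderiv ℝ f x v.1) := by
  have hfc := hf.continuous
  have hcd := hh.continuous_fderiv one_ne_zero
  have hbound : ∀ w : Plane × ℝ, Integrable fun z : Plane × ℝ =>
      fderiv ℝ h (cylEquiv (shear hfc z)) (cylEquiv w) := by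
    intro w
    refine integrable_comp_shear hfc (g := fun y => fderiv ℝ h y (cylEquiv w)) (by fun_prop) ?_
    exact (hc.fderiv ℝ).mono fun y hy h0 => hy (by simp [h0])
  have hmeas : Measurable fun z : Plane × ℝ => fderiv ℝ f z.1 v.1 :=
    (measurable_fderiv_apply_const ℝ f v.1).comp measurable_fst
  have hb : ∀ z : Plane × ℝ, ‖fderiv ℝ f z.1 v.1‖ ≤ K * ‖v.1‖ := fun z =>
    norm_fderiv_apply_le_of_lipschitz hf _ _
  have i3 : Integrable fun z : Plane × ℝ =>
      (v.2 - fderiv ℝ f z.1 v.1) * fderiv ℝ h (cylEquiv (shear hfc z)) (cylEquiv (0, 1)) := by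
    refine (hbound (0, 1)).bdd_mul (c := ‖v.2‖ + K * ‖v.1‖)
      (measurable_const.sub hmeas).aestronglyMeasurable ?_
    exact Filter.Eventually.of_forall fun z => (norm_sub_le _ _).trans (by gcongr; exact hb z)
  -- split `v` into a part tangential to the graph and a vertical part
  have hsplit : ∀ z : Plane × ℝ, fderiv ℝ h (cylEquiv (shear hfc z)) (cylEquiv v) =
      fderiv ℝ h (cylEquiv (z.1, f z.1 + z.2)) (cylEquiv (v.1, fderiv ℝ f z.1 v.1)) +
      (v.2 - fderiv ℝ f z.1 v.1) * fderiv ℝ h (cylEquiv (shear hfc z)) (cylEquiv (0, 1)) := by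
    intro z
    have : v = (v.1, fderiv ℝ f z.1 v.1) + (v.2 - fderiv ℝ f z.1 v.1) • ((0, 1) : Plane × ℝ) := by
      ext <;> simp
    conv_lhs => rw [this, map_add, map_smul, map_add, map_smul]
    rfl
  have i2 : Integrable fun z : Plane × ℝ =>
      fderiv ℝ h (cylEquiv (z.1, f z.1 + z.2)) (cylEquiv (v.1, fderiv ℝ f z.1 v.1)) := by
    refine ((hbound v).sub i3).congr (Filter.Eventually.of_forall fun z => ?_)
    simp only [Pi.sub_apply, hsplit z, add_sub_cancel_right]
  rw [setIntegral_subgraph hfc]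
  simp only [hsplit]
  rw [integral_add i2.integrableOn i3.integrableOn, Measure.volume_eq_prod,
    ← Measure.prod_restrict, Measure.restrict_univ]
  have r : (volume : Measure Plane).prod ((volume : Measure ℝ).restrict (Iio 0)) ≤
      (volume : Measure (Plane × ℝ)) := by
    conv_lhs => rw [← Measure.restrict_univ (μ := (volume : Measure Plane))]
    rw [Measure.prod_restrict]
    exact Measure.restrict_le_self
  rw [integral_prod_symm _ (i2.mono_measure r), integral_prod _ (i3.mono_measure r)]
  simp only [integral_tangential_eq_zero hf hh hc, integral_zero, zero_add]
  refine integral_congr_ae (Filter.Eventually.of_forall fun x => ?_)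
  simp only [integral_const_mul]
  have := integral_vertical hh hc x (f x)
  simp only [shear, Homeomorph.homeomorph_mk_coe, Equiv.coe_fn_mk]
  rw [this, mul_comm]
  rfl

/-! ### Outward normals -/

lemma IsOutwardNormal.unique {B : Set Space} {x ν ν' : Space} (h : IsOutwardNormal B x ν)
    (h' : IsOutwardNormal B x ν') : ν = ν' := by
  by_contra hne
  set w := ν' - ν with hw
  have hwn : 0 < ‖w‖ := norm_pos_iff.2 (sub_ne_zero.2 (Ne.symm hne))
  have hc : inner ℝ ν' ν < 1 := (inner_lt_one_iff_real_of_norm_eq_one h'.1 h.1).2 (Ne.symm hne)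
  set c := 1 - inner ℝ ν' ν with hcdef
  have hcpos : 0 < c := by linarith
  have e1 : inner ℝ w ν = -c := by
    rw [hw, inner_sub_left, real_inner_self_eq_norm_sq, h.1]; simp [hcdef]
  have e2 : inner ℝ w ν' = c := by
    rw [hw, inner_sub_left, real_inner_self_eq_norm_sq, h'.1, real_inner_comm]; simp [hcdef]
  set ε := c / (2 * ‖w‖)
  have hε : 0 < ε := by positivity
  have hεw : ε * ‖w‖ = c / 2 := by simp only [ε]; field_simp
  have ht : Filter.Tendsto (fun t : ℝ => x + t • w) (𝓝[>] 0) (𝓝 x) := by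
    have : Continuous fun t : ℝ => x + t • w := by fun_prop
    simpa using (this.tendsto 0).mono_left nhdsWithin_le_nhds
  -- moving from `x` along `ν' - ν` one would enter `B` and leave it at the same time
  obtain ⟨t, ⟨h1, h2⟩, ht0⟩ :=
    ((ht.eventually ((h.2 ε hε).and (h'.2 ε hε))).and self_mem_nhdsWithin).exists
  have ht0 : 0 < t := ht0
  simp only [add_sub_cancel_left, inner_smul_left, norm_smul, e1, e2, Real.norm_eq_abs,
    abs_of_pos ht0, conj_trivial] at h1 h2
  exact h2.2 (by nlinarith [mul_pos ht0 hcpos]) (h1.1 (by nlinarith [mul_pos ht0 hcpos]))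

lemma IsOutwardNormal.outwardNormal_eq {B : Set Space} {x ν : Space} (h : IsOutwardNormal B x ν) :
    outwardNormal B x = WithLp.ofLp ν := by
  have hex : ∃ ν, IsOutwardNormal B x ν := ⟨ν, h⟩
  rw [outwardNormal, dif_pos hex, hex.choose_spec.unique h]

lemma norm_outwardNormal_le (B : Set Space) (x : Space) :
    ‖WithLp.toLp 2 (outwardNormal B x)‖ ≤ 1 := by
  by_cases hex : ∃ ν, IsOutwardNormal B x ν
  · rw [outwardNormal, dif_pos hex, WithLp.toLp_ofLp, hex.choose_spec.1]
  · rw [outwardNormal, dif_neg hex]; simp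

lemma abs_outwardNormal_le (B : Set Space) (x : Space) (j : Fin 3) :
    |outwardNormal B x j| ≤ 1 := by
  have h := PiLp.norm_apply_le (WithLp.toLp 2 (outwardNormal B x)) j
  exact h.trans (norm_outwardNormal_le B x)

lemma inner_cylEquiv (z w : Plane × ℝ) :
    inner ℝ (cylEquiv z) (cylEquiv w) = inner ℝ z.1 w.1 + z.2 * w.2 := by
  rw [cylEquiv_apply, cylEquiv_apply]
  simp [PiLp.inner_apply, Fin.sum_univ_succ]
  ring

/-- The upward unit normal of the graph of `f` above `x`, in Cartesian coordinates related to
those of the graph by `R`. -/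
noncomputable def graphNormal (R : Space ≃ₗᵢ[ℝ] Space) (f : Plane → ℝ) (x : Plane) : Space :=
  (graphJacobian (fderiv ℝ f x))⁻¹ •
    R.symm (cylEquiv (-(InnerProductSpace.toDual ℝ Plane).symm (fderiv ℝ f x), 1))

lemma measurable_graphNormal (R : Space ≃ₗᵢ[ℝ] Space) (f : Plane → ℝ) :
    Measurable (graphNormal R f) := by
  have hJ : Measurable fun x => graphJacobian (fderiv ℝ f x) :=
    continuous_graphJacobian.measurable.comp (measurable_fderiv ℝ f)
  refine hJ.inv.smul ?_
  have h : Continuous fun a : Plane →L[ℝ] ℝ =>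
      R.symm (cylEquiv (-(InnerProductSpace.toDual ℝ Plane).symm a, (1 : ℝ))) := by fun_prop
  exact h.measurable.comp (measurable_fderiv ℝ f)

lemma inner_graphNormal (R : Space ≃ₗᵢ[ℝ] Space) (f : Plane → ℝ) (x : Plane) (y : Space) :
    inner ℝ y (graphNormal R f x) = (graphJacobian (fderiv ℝ f x))⁻¹ *
      ((cylEquiv.symm (R y)).2 - fderiv ℝ f x (cylEquiv.symm (R y)).1) := by
  rw [graphNormal, inner_smul_right]
  congr 1
  have : inner ℝ y (R.symm (cylEquiv (-(InnerProductSpace.toDual ℝ Plane).symm (fderiv ℝ f x), 1)))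
      = inner ℝ (cylEquiv (cylEquiv.symm (R y)))
        (cylEquiv (-(InnerProductSpace.toDual ℝ Plane).symm (fderiv ℝ f x), 1)) := by
    rw [← R.inner_map_map, R.apply_symm_apply, cylEquiv.apply_symm_apply]
  rw [this, inner_cylEquiv, inner_neg_right, real_inner_comm,
    InnerProductSpace.toDual_symm_apply]
  ring

lemma norm_graphNormal (R : Space ≃ₗᵢ[ℝ] Space) (f : Plane → ℝ) (x : Plane) :
    ‖graphNormal R f x‖ = 1 := by
  have hJ := graphJacobian_pos (fderiv ℝ f x)
  have h : ‖cylEquiv (-(InnerProductSpace.toDual ℝ Plane).symm (fderiv ℝ f x), 1)‖ =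
      graphJacobian (fderiv ℝ f x) := by
    rw [← Real.sqrt_sq (norm_nonneg (cylEquiv _)), norm_cylEquiv_sq, graphJacobian]
    simp only [norm_neg, LinearIsometryEquiv.norm_map]
    congr 1; ring
  rw [graphNormal, norm_smul, LinearIsometryEquiv.norm_map, h, norm_inv, Real.norm_eq_abs,
    abs_of_pos hJ, inv_mul_cancel₀ hJ.ne']

/-- The point of the boundary above `x` in a chart given by `R` and `f`. -/
noncomputable def chartMap (R : Space ≃ₗᵢ[ℝ] Space) (f : Plane → ℝ) (x : Plane) : Space :=
  R.symm (graphMap f x)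

lemma isGraphParam_chartMap (R : Space ≃ₗᵢ[ℝ] Space) (f : Plane → ℝ) :
    IsGraphParam f (chartMap R f) := by
  intro x y
  rw [chartMap, chartMap, R.symm.dist_map]
  exact isGraphParam_graphMap f x y

lemma mem_range_chartMap {R : Space ≃ₗᵢ[ℝ] Space} {f : Plane → ℝ} {y : Space} :
    y ∈ range (chartMap R f) ↔ (cylEquiv.symm (R y)).2 = f (cylEquiv.symm (R y)).1 := by
  constructor
  · rintro ⟨x, rfl⟩
    simp [chartMap, graphMap]
  · intro h
    refine ⟨(cylEquiv.symm (R y)).1, ?_⟩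
    rw [chartMap, graphMap, ← h, Prod.mk.eta, cylEquiv.apply_symm_apply, R.symm_apply_apply]

lemma mem_subgraph_iff {f : Plane → ℝ} {y : Space} :
    y ∈ subgraph f ↔ (cylEquiv.symm y).2 < f (cylEquiv.symm y).1 := Iff.rfl

lemma isOpen_subgraph {f : Plane → ℝ} (hf : Continuous f) : IsOpen (subgraph f) := by
  have : subgraph f = {y | (cylEquiv.symm y).2 < f (cylEquiv.symm y).1} := rfl
  rw [this]
  exact isOpen_lt (by fun_prop) (by fun_prop)

/-- At a point above which `f` is differentiable, the graph normal is the outward normal of a body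
that lies locally below the graph. -/
lemma isOutwardNormal_graphNormal {B : Set Space} {R : Space ≃ₗᵢ[ℝ] Space} {f : Plane → ℝ}
    {x : Plane} (hx : DifferentiableAt ℝ f x)
    (hB : ∀ᶠ y in 𝓝 (chartMap R f x), (y ∈ B ↔ R y ∈ subgraph f)) :
    IsOutwardNormal B (chartMap R f x) (graphNormal R f x) := by
  refine ⟨norm_graphNormal R f x, fun ε hε => ?_⟩
  have hJ := one_le_graphJacobian (fderiv ℝ f x)
  set J := graphJacobian (fderiv ℝ f x) with hJdef
  set π : Space → Plane := fun y => (cylEquiv.symm (R y)).1 with hπ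
  have hπx : π (chartMap R f x) = x := by simp [hπ, chartMap, graphMap]
  have hπc : Continuous π := by fun_prop
  have hπt : Filter.Tendsto π (𝓝 (chartMap R f x)) (𝓝 x) := by
    simpa [hπx] using hπc.tendsto (chartMap R f x)
  have ho := hπt.eventually (hx.hasFDerivAt.isLittleO.def hε)
  filter_upwards [hB, ho] with y hy hoy
  have hd : ‖π y - x‖ ≤ ‖y - chartMap R f x‖ := by
    have h2 : ‖y - chartMap R f x‖ ^ 2 = ‖π y - x‖ ^ 2 + ((cylEquiv.symm (R y)).2 - f x) ^ 2 := by
      rw [← R.norm_map, map_sub, chartMap, R.apply_symm_apply, graphMap,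
        ← cylEquiv.apply_symm_apply (R y), ← map_sub, norm_cylEquiv_sq]
      simp [hπ]
    apply (pow_le_pow_iff_left₀ (norm_nonneg _) (norm_nonneg _) two_ne_zero).1
    rw [h2]; nlinarith [sq_nonneg ((cylEquiv.symm (R y)).2 - f x)]
  have hin : inner ℝ (y - chartMap R f x) (graphNormal R f x) =
      J⁻¹ * ((cylEquiv.symm (R y)).2 - f x - fderiv ℝ f x (π y - x)) := by
    rw [inner_graphNormal]
    simp [chartMap, graphMap, hπ, hJdef]
  rw [hin]
  have hoy' := abs_le.1 ((Real.norm_eq_abs _).symm.le.trans (hoy.trans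
    (mul_le_mul_of_nonneg_left hd hε.le)))
  set r := ‖y - chartMap R f x‖
  have hr : 0 ≤ r := norm_nonneg _
  set s := (cylEquiv.symm (R y)).2 - f x - fderiv ℝ f x (π y - x) with hs
  have hJr : ε * r ≤ J * (ε * r) := le_mul_of_one_le_left (by positivity) hJ
  rw [hy, mem_subgraph_iff]
  change (_ → _ < f (π y)) ∧ (_ → ¬ _ < f (π y))
  constructor
  · intro h
    have : s < J * -(ε * r) := by rwa [inv_mul_lt_iff₀ (by linarith)] at h
    linarith [hoy'.1]
  · intro h
    have : J * (ε * r) < s := by rwa [lt_inv_mul_iff₀ (by linarith)] at h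
    linarith [hoy'.2]

/-! ### The boundary of a Lipschitz body -/

/-- Inside a chart domain the boundary is the graph. -/
lemma inter_frontier_eq_inter_range {B W : Set Space} {R : Space ≃ₗᵢ[ℝ] Space} {f : Plane → ℝ}
    (hf : Continuous f) (hW : IsOpen W) (hB : ∀ y ∈ W, (y ∈ B ↔ R y ∈ subgraph f)) :
    W ∩ frontier B = W ∩ range (chartMap R f) := by
  have hπ : Continuous fun y => cylEquiv.symm (R y) := by fun_prop
  ext y
  simp only [mem_inter_iff, and_congr_right_iff]
  intro hyW
  have h1 : y ∈ frontier B ↔ y ∈ frontier (R ⁻¹' subgraph f) := by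
    have he : B ∩ W = R ⁻¹' subgraph f ∩ W := by
      ext z
      exact and_congr_left fun hz => hB z hz
    have hf1 := frontier_inter_open_inter (s := B) hW
    rw [he, frontier_inter_open_inter hW] at hf1
    have := congrArg (fun S => y ∈ S) hf1
    simpa [hyW] using (iff_of_eq this).symm
  rw [h1, mem_range_chartMap]
  constructor
  · intro h
    exact frontier_lt_subset_eq (f := fun y => (cylEquiv.symm (R y)).2)
      (g := fun y => f (cylEquiv.symm (R y)).1) (by fun_prop) (by fun_prop) h
  · intro h
    rw [(isOpen_subgraph hf |>.preimage R.continuous).frontier_eq]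
    refine ⟨?_, fun hy => (mem_subgraph_iff.1 hy).ne h⟩
    have ht : Filter.Tendsto (fun t : ℝ => y + t • R.symm (cylEquiv (0, 1))) (𝓝[<] 0) (𝓝 y) := by
      have : Continuous fun t : ℝ => y + t • R.symm (cylEquiv (0, 1)) := by fun_prop
      simpa using (this.tendsto 0).mono_left nhdsWithin_le_nhds
    refine mem_closure_of_tendsto ht ?_
    filter_upwards [self_mem_nhdsWithin] with t (ht : t < 0)
    rw [mem_preimage, mem_subgraph_iff]
    simp [h, ht]

/-- Boundary integrals in a chart. -/
lemma restrict_range_chartMap (R : Space ≃ₗᵢ[ℝ] Space) {f : Plane → ℝ} {K : ℝ≥0}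
    (hf : LipschitzWith K f) :
    (μHE[2] : Measure Space).restrict (range (chartMap R f)) =
      ((volume : Measure Plane).withDensity
        fun x => ENNReal.ofReal (graphJacobian (fderiv ℝ f x))).map (chartMap R f) := by
  have hG := isGraphParam_chartMap R f
  rw [← hG.comap_eq_withDensity hf,
    (hG.isClosedEmbedding hf).measurableEmbedding.map_comap]

/-- The properties of the boundary near each of its points that localise: finite area, an almost
everywhere defined measurable normal, and the divergence theorem for fields supported there. -/
structure IsRegularAt (B W : Set Space) : Prop where
  isOpen : IsOpen W
  bounded : Bornology.IsBounded W
  area_lt_top : (μHE[2] : Measure Space) (W ∩ frontier B) < ∞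
  measurable_normal : AEMeasurable (outwardNormal B)
    ((μHE[2] : Measure Space).restrict (W ∩ frontier B))
  exists_normal : ∀ᵐ y ∂(μHE[2] : Measure Space).restrict (W ∩ frontier B),
    ∃ ν, IsOutwardNormal B y ν
  divergence : ∀ h : Space → ℝ, ContDiff ℝ 1 h → HasCompactSupport h → tsupport h ⊆ W → ∀ v,
    ∫ y in B, fderiv ℝ h y v =
      ∫ y in frontier B, h y * inner ℝ v (WithLp.toLp 2 (outwardNormal B y)) ∂μHE[2]

/-- Where the boundary is a Lipschitz graph, the area formula and the divergence theorem below the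
graph yield the local properties: the area density cancels the normalisation of the normal. -/
lemma isRegularAt_of_chart {B W : Set Space} (hBo : IsOpen B) {R : Space ≃ₗᵢ[ℝ] Space}
    {f : Plane → ℝ} {K : ℝ≥0} (hf : LipschitzWith K f) (hW : IsOpen W)
    (hWb : Bornology.IsBounded W) (hB : ∀ y ∈ W, (y ∈ B ↔ R y ∈ subgraph f)) :
    IsRegularAt B W := by
  have hG := isGraphParam_chartMap R f
  have hemb := (hG.isClosedEmbedding hf).measurableEmbedding
  have hfr := inter_frontier_eq_inter_range hf.continuous hW hB
  set J : Plane → ℝ≥0∞ := fun x => ENNReal.ofReal (graphJacobian (fderiv ℝ f x)) with hJ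
  have hJm : Measurable J := ENNReal.measurable_ofReal.comp
    (continuous_graphJacobian.measurable.comp (measurable_fderiv ℝ f))
  have hres : (μHE[2] : Measure Space).restrict (W ∩ frontier B) =
      (((volume : Measure Plane).withDensity J).restrict (chartMap R f ⁻¹' W)).map
        (chartMap R f) := by
    rw [hfr, ← Measure.restrict_restrict hW.measurableSet, restrict_range_chartMap R hf,
      Measure.restrict_map hemb.measurable hW.measurableSet]
  have hnormal : ∀ᵐ x ∂(volume : Measure Plane).withDensity J, chartMap R f x ∈ W →
      IsOutwardNormal B (chartMap R f x) (graphNormal R f x) := by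
    filter_upwards [(withDensity_absolutelyContinuous _ J).ae_le hf.ae_differentiableAt]
      with x hx hxW
    refine isOutwardNormal_graphNormal hx ?_
    filter_upwards [hW.mem_nhds hxW] with y hy using hB y hy
  have hWm : MeasurableSet (chartMap R f ⁻¹' W) := hemb.measurable hW.measurableSet
  refine ⟨hW, hWb, ?_, ?_, ?_, ?_⟩
  · rw [hfr, ← image_preimage_eq_inter_range]
    have h : (μHE[2] : Measure Space) (chartMap R f '' (chartMap R f ⁻¹' W)) ≤
        ((1 + K : ℝ≥0) : ℝ≥0∞) ^ 2 * (μHE[2] : Measure Plane) (id '' (chartMap R f ⁻¹' W)) :=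
      euclideanHausdorffMeasure_image_le_of_edist_le 2 fun x _ y _ => (hG.lipschitz hf) x y
    rw [image_id, EuclideanSpace.euclideanHausdorffMeasure_eq_volume] at h
    refine h.trans_lt (ENNReal.mul_lt_top (by finiteness) ?_)
    exact (hG.antilipschitz.isBounded_preimage hWb).measure_lt_top
  · rw [hres, hemb.aemeasurable_map_iff]
    refine ⟨fun x => WithLp.ofLp (graphNormal R f x), ?_, ?_⟩
    · exact (PiLp.continuous_ofLp 2 _).measurable.comp (measurable_graphNormal R f)
    · filter_upwards [(ae_restrict_iff' hWm).2 hnormal] with x hx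
      exact hx.outwardNormal_eq
  · rw [hres, hemb.ae_map_iff]
    filter_upwards [(ae_restrict_iff' hWm).2 hnormal] with x hx
    exact ⟨_, hx⟩
  · intro h hh hc hsupp v
    have h0 : ∀ y, y ∉ W → h y = 0 := fun y hy => image_eq_zero_of_notMem_tsupport
      fun hy' => hy (hsupp hy')
    have hd0 : ∀ y, y ∉ W → fderiv ℝ h y = 0 := fun y hy => by
      by_contra hne
      exact hy (hsupp (support_fderiv_subset ℝ hne))
    have hΩ : MeasurableSet (subgraph f) := (isOpen_subgraph hf.continuous).measurableSet
    have hΩR : MeasurableSet (R ⁻¹' subgraph f) := R.continuous.measurable hΩ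
    calc ∫ y in B, fderiv ℝ h y v = ∫ y in R ⁻¹' subgraph f, fderiv ℝ h y v := by
          rw [← integral_indicator hBo.measurableSet, ← integral_indicator hΩR]
          congr 1
          ext y
          by_cases hy : y ∈ W
          · by_cases hyB : y ∈ B
            · rw [indicator_of_mem hyB,
                indicator_of_mem (show y ∈ R ⁻¹' subgraph f from (hB y hy).1 hyB)]
            · rw [indicator_of_notMem hyB,
                indicator_of_notMem (show y ∉ R ⁻¹' subgraph f from fun hy' =>
                  hyB ((hB y hy).2 hy'))]
          · simp [indicator, hd0 y hy]
      _ = ∫ y in subgraph f, fderiv ℝ (h ∘ R.symm) y (cylEquiv (cylEquiv.symm (R v))) := by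
          rw [← R.measurePreserving.setIntegral_preimage_emb
            R.toHomeomorph.measurableEmbedding _ (subgraph f)]
          refine integral_congr_ae (Filter.Eventually.of_forall fun y => ?_)
          have e : fderiv ℝ (h ∘ R.symm) (R y) = (fderiv ℝ h (R.symm (R y))).comp
              (R.symm.toContinuousLinearEquiv : Space →L[ℝ] Space) :=
            (((hh.differentiable one_ne_zero) (R.symm (R y))).hasFDerivAt.comp (R y)
              R.symm.toContinuousLinearEquiv.hasFDerivAt).fderiv
          simp [e]
      _ = ∫ x, h (chartMap R f x) *
            ((cylEquiv.symm (R v)).2 - fderiv ℝ f x (cylEquiv.symm (R v)).1) := by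
          rw [setIntegral_fderiv_subgraph hf]
          · rfl
          · exact hh.comp R.symm.contDiff
          · exact hc.comp_homeomorph R.symm.toHomeomorph
      _ = ∫ y in range (chartMap R f),
            h y * inner ℝ v (WithLp.toLp 2 (outwardNormal B y)) ∂μHE[2] := by
          rw [restrict_range_chartMap R hf, hemb.integral_map,
            integral_withDensity_eq_integral_toReal_smul hJm
              (Filter.Eventually.of_forall fun x => ENNReal.ofReal_lt_top)]
          refine integral_congr_ae ?_
          filter_upwards [hf.ae_differentiableAt] with x hx
          have hJp := graphJacobian_pos (fderiv ℝ f x)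
          by_cases hxW : chartMap R f x ∈ W
          · have hn := isOutwardNormal_graphNormal (B := B) hx
              (by filter_upwards [hW.mem_nhds hxW] with y hy using hB y hy)
            rw [hn.outwardNormal_eq, WithLp.toLp_ofLp, inner_graphNormal, hJ]
            simp only [ENNReal.toReal_ofReal hJp.le, smul_eq_mul]
            field_simp
          · simp [h0 _ hxW]
      _ = ∫ y in W ∩ frontier B,
            h y * inner ℝ v (WithLp.toLp 2 (outwardNormal B y)) ∂μHE[2] := by
          rw [hfr]
          refine setIntegral_eq_of_subset_of_forall_sdiff_eq_zero hemb.measurableSet_range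
            inter_subset_right fun y hy => ?_
          rw [h0 y fun hyW => hy.2 ⟨hyW, hy.1⟩, zero_mul]
      _ = _ := by
          symm
          refine setIntegral_eq_of_subset_of_forall_sdiff_eq_zero isClosed_frontier.measurableSet
            inter_subset_right fun y hy => ?_
          rw [h0 y fun hyW => hy.2 ⟨hyW, hy.1⟩, zero_mul]

lemma IsLipschitzBody.exists_isRegularAt {B : Set Space} (hB : IsLipschitzBody B) {x : Space}
    (hx : x ∈ frontier B) : ∃ W, x ∈ W ∧ IsRegularAt B W := by
  obtain ⟨R, f, K, hf, he⟩ := hB.2.2 x hx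
  obtain ⟨r, hr, hrB⟩ := Metric.eventually_nhds_iff_ball.1 he
  exact ⟨Metric.ball x r, Metric.mem_ball_self hr,
    isRegularAt_of_chart hB.1 hf Metric.isOpen_ball Metric.isBounded_ball hrB⟩

lemma IsLipschitzBody.isCompact_closure {B : Set Space} (hB : IsLipschitzBody B) :
    IsCompact (closure B) := hB.2.1.isCompact_closure

lemma IsLipschitzBody.exists_finite_cover {B : Set Space} (hB : IsLipschitzBody B) :
    ∃ (t : Finset Space) (W : Space → Set Space), (∀ x ∈ t, IsRegularAt B (W x)) ∧
      frontier B ⊆ ⋃ x ∈ t, W x := by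
  choose! W hxW hW using fun x (hx : x ∈ frontier B) => hB.exists_isRegularAt hx
  have hc : IsCompact (frontier B) :=
    hB.isCompact_closure.of_isClosed_subset isClosed_frontier frontier_subset_closure
  obtain ⟨t, htB, ht⟩ := hc.elim_nhds_subcover W
    fun x hx => (hW x hx).isOpen.mem_nhds (hxW x hx)
  exact ⟨t, W, fun x hx => hW x (htB x hx), ht⟩

lemma eq_iUnion_inter_of_cover {B : Set Space} {t : Finset Space} {W : Space → Set Space}
    (h : frontier B ⊆ ⋃ x ∈ t, W x) : frontier B = ⋃ x : t, W x ∩ frontier B := by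
  rw [← iUnion_inter, iUnion_subtype, inter_eq_right.2 h]

lemma IsLipschitzBody.isFiniteMeasure_surfaceMeasure {B : Set Space} (hB : IsLipschitzBody B) :
    IsFiniteMeasure (surfaceMeasure (frontier B)) := by
  obtain ⟨t, W, hW, ht⟩ := hB.exists_finite_cover
  refine ⟨?_⟩
  rw [surfaceMeasure, Measure.restrict_apply_univ, eq_iUnion_inter_of_cover ht]
  exact (measure_iUnion_le _).trans_lt (by
    rw [tsum_fintype]
    exact ENNReal.sum_lt_top.2 fun x _ => (hW x x.2).area_lt_top)

lemma IsLipschitzBody.aemeasurable_outwardNormal {B : Set Space} (hB : IsLipschitzBody B) :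
    AEMeasurable (outwardNormal B) (surfaceMeasure (frontier B)) := by
  obtain ⟨t, W, hW, ht⟩ := hB.exists_finite_cover
  rw [surfaceMeasure, eq_iUnion_inter_of_cover ht, aemeasurable_iUnion_iff]
  exact fun x => (hW x x.2).measurable_normal

/-- A Lipschitz body has an outward unit normal at almost every boundary point. -/
lemma IsLipschitzBody.ae_exists_normal {B : Set Space} (hB : IsLipschitzBody B) :
    ∀ᵐ y ∂surfaceMeasure (frontier B), ∃ ν, IsOutwardNormal B y ν := by
  obtain ⟨t, W, hW, ht⟩ := hB.exists_finite_cover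
  rw [surfaceMeasure, eq_iUnion_inter_of_cover ht, ae_restrict_iUnion_iff]
  exact fun x => (hW x x.2).exists_normal

lemma outwardNormal_ne_zero {B : Set Space} {y : Space} (h : ∃ ν, IsOutwardNormal B y ν) :
    outwardNormal B y ≠ 0 := by
  obtain ⟨ν, hν⟩ := h
  rw [hν.outwardNormal_eq]
  intro h0
  have : ν = 0 := by
    ext i; exact congrFun h0 i
  have h1 := hν.1
  simp [this] at h1

lemma integrableOn_of_continuous_of_isBounded {E : Type*} [MetricSpace E] [ProperSpace E]
    [MeasurableSpace E] [OpensMeasurableSpace E] {μ : Measure E} [IsFiniteMeasureOnCompacts μ]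
    {B : Set E} (hB : Bornology.IsBounded B) {g : E → ℝ} (hg : Continuous g) :
    IntegrableOn g B μ :=
  (hg.continuousOn.integrableOn_compact hB.isCompact_closure).mono_set subset_closure

/-- A continuous function is integrable over the boundary, also after multiplication with a
component of the normal. -/
lemma IsLipschitzBody.integrable_mul_normal {B : Set Space} (hB : IsLipschitzBody B)
    {g : Space → ℝ} (hg : Continuous g) (j : Fin 3) :
    Integrable (fun y => g y * outwardNormal B y j) (surfaceMeasure (frontier B)) := by
  have := hB.isFiniteMeasure_surfaceMeasure
  have hc : IsCompact (frontier B) :=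
    hB.isCompact_closure.of_isClosed_subset isClosed_frontier frontier_subset_closure
  obtain ⟨C, hC⟩ := hc.exists_bound_of_continuousOn hg.continuousOn
  have hn : AEStronglyMeasurable (fun y => outwardNormal B y j) (surfaceMeasure (frontier B)) :=
    ((measurable_pi_apply j).comp_aemeasurable hB.aemeasurable_outwardNormal).aestronglyMeasurable
  refine Integrable.of_bound (hg.aestronglyMeasurable.mul hn) C ?_
  filter_upwards [ae_restrict_mem isClosed_frontier.measurableSet] with y hy
  rw [norm_mul]
  calc _ ≤ ‖g y‖ * 1 := by gcongr; exact abs_outwardNormal_le B y j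
    _ ≤ C := by rw [mul_one]; exact hC y hy

/-- The divergence theorem on Lipschitz bodies. A partition of unity reduces it to fields supported
inside the body and fields supported in a boundary chart. -/
theorem IsLipschitzBody.setIntegral_partialDeriv {B : Set Space} (hB : IsLipschitzBody B)
    {h : Space → ℝ} (hh : ContDiff ℝ 1 h) (j : Fin 3) :
    ∫ y in B, partialDeriv j h y = ∫ y, h y * outwardNormal B y j ∂surfaceMeasure (frontier B) := by
  obtain ⟨t, W, hW, ht⟩ := hB.exists_finite_cover
  set U : Option t → Set Space := fun o => o.elim B fun x => W x with hU
  have hUo : ∀ i, IsOpen (U i) := by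
    rintro (_ | x)
    · exact hB.1
    · exact (hW x x.2).isOpen
  have hUb : ∀ i, Bornology.IsBounded (U i) := by
    rintro (_ | x)
    · exact hB.2.1
    · exact (hW x x.2).bounded
  have hcover : closure B ⊆ ⋃ i, U i := by
    intro y hy
    rw [mem_iUnion]
    by_cases hyB : y ∈ B
    · exact ⟨none, hyB⟩
    · have hyf : y ∈ frontier B := by rw [hB.1.frontier_eq]; exact ⟨hy, hyB⟩
      obtain ⟨x, hx, hyx⟩ := mem_iUnion₂.1 (ht hyf)
      exact ⟨some ⟨x, hx⟩, hyx⟩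
  obtain ⟨p, hp⟩ := SmoothPartitionOfUnity.exists_isSubordinate (modelWithCornersSelf ℝ Space)
    isClosed_closure U hUo hcover
  have hpc : ∀ i, ContDiff ℝ 1 (p i) := fun i => (p i).contMDiff.contDiff.of_le (by simp)
  have hsum : ∀ y ∈ closure B, ∑ i, p i y = 1 := fun y hy => by
    rw [← finsum_eq_sum_of_fintype]; exact p.sum_eq_one hy
  set g : Option t → Space → ℝ := fun i y => p i y * h y with hg
  have hgc : ∀ i, ContDiff ℝ 1 (g i) := fun i => (hpc i).mul hh
  have hgU : ∀ i, tsupport (g i) ⊆ U i := fun i =>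
    (tsupport_mul_subset_left (f := p i)).trans (hp i)
  have hgcs : ∀ i, HasCompactSupport (g i) := fun i =>
    Metric.isCompact_of_isClosed_isBounded (isClosed_tsupport _) ((hUb i).subset (hgU i))
  have hgsum : ∀ y ∈ closure B, ∑ i, g i y = h y := fun y hy => by
    simp only [hg, ← Finset.sum_mul, hsum y hy, one_mul]
  have hpiece : ∀ i, ∫ y in B, partialDeriv j (g i) y =
      ∫ y, g i y * outwardNormal B y j ∂surfaceMeasure (frontier B) := by
    rintro (_ | x)
    · have h1 : ∀ y ∈ frontier B, g none y = 0 := fun y hy =>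
        image_eq_zero_of_notMem_tsupport fun hy' => by
          have : y ∈ B := hgU none hy'
          rw [hB.1.frontier_eq] at hy
          exact hy.2 this
      have h2 : ∫ y, g none y * outwardNormal B y j ∂surfaceMeasure (frontier B) = 0 := by
        refine integral_eq_zero_of_ae ?_
        filter_upwards [ae_restrict_mem isClosed_frontier.measurableSet] with y hy
        simp [h1 y hy]
      obtain ⟨L, hL⟩ := (hgc none).lipschitzWith_of_hasCompactSupport (hgcs none) one_ne_zero
      rw [h2, setIntegral_eq_integral_of_forall_compl_eq_zero,
        ← integral_lineDeriv_eq_zero (μ := volume) hL (hgcs none) (EuclideanSpace.single j 1)]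
      · refine integral_congr_ae (Filter.Eventually.of_forall fun y => ?_)
        exact (((hgc none).differentiable one_ne_zero y).lineDeriv_eq_fderiv).symm
      · intro y hy
        have : fderiv ℝ (g none) y = 0 := by
          by_contra hne
          exact hy (hgU none (support_fderiv_subset ℝ hne))
        simp [partialDeriv, this]
    · have := (hW x x.2).divergence (g (some x)) (hgc _) (hgcs _) (hgU (some x))
        (EuclideanSpace.single j 1)
      simp only [EuclideanSpace.inner_single_left, map_one, one_mul] at this
      exact this
  have hDc : ∀ i, Continuous (partialDeriv j (g i)) := fun i =>
    ((hgc i).continuous_fderiv one_ne_zero).clm_apply continuous_const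
  calc ∫ y in B, partialDeriv j h y = ∫ y in B, ∑ i, partialDeriv j (g i) y := by
        refine setIntegral_congr_fun hB.1.measurableSet fun y hy => ?_
        have he : h =ᶠ[𝓝 y] fun y => ∑ i, g i y := by
          filter_upwards [hB.1.mem_nhds hy] with z hz using (hgsum z (subset_closure hz)).symm
        simp only [partialDeriv]
        rw [he.fderiv_eq, fderiv_fun_sum fun i _ => (hgc i).differentiable one_ne_zero y]
        simp
    _ = ∑ i, ∫ y in B, partialDeriv j (g i) y :=
        integral_finsetSum _ fun i _ => integrableOn_of_continuous_of_isBounded hB.2.1 (hDc i)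
    _ = ∑ i, ∫ y, g i y * outwardNormal B y j ∂surfaceMeasure (frontier B) :=
        Finset.sum_congr rfl fun i _ => hpiece i
    _ = ∫ y, ∑ i, g i y * outwardNormal B y j ∂surfaceMeasure (frontier B) :=
        (integral_finsetSum _ fun i _ => hB.integrable_mul_normal (hgc i).continuous j).symm
    _ = _ := by
        refine integral_congr_ae ?_
        filter_upwards [ae_restrict_mem isClosed_frontier.measurableSet] with y hy
        rw [← Finset.sum_mul, hgsum y (frontier_subset_closure hy)]

/-! ### Derivatives in space-time -/

/-- Time-dependent vector fields of class `Cⁿ`. -/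
def VecC (n : WithTop ℕ∞) (v : ℝ → Space → Vec) : Prop :=
  ∀ i, ContDiff ℝ n fun z : ℝ × Space => v z.1 z.2 i

/-- The time derivative of a vector field. -/
noncomputable def timeDeriv (v : ℝ → Space → Vec) (t : ℝ) (x : Space) : Vec :=
  deriv (fun τ => v τ x) t

section Slices

variable {g : ℝ × Space → ℝ} {n : WithTop ℕ∞}

lemma hasDerivAt_time (hg : ContDiff ℝ 1 g) (t : ℝ) (x : Space) :
    HasDerivAt (fun τ => g (τ, x)) (fderiv ℝ g (t, x) (1, 0)) t :=
  (hg.differentiable one_ne_zero (t, x)).hasFDerivAt.comp_hasDerivAt t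
    ((hasDerivAt_id t).prodMk (hasDerivAt_const t x))

lemma partialDeriv_slice (hg : ContDiff ℝ 1 g) (j : Fin 3) (t : ℝ) (x : Space) :
    partialDeriv j (fun y => g (t, y)) x = fderiv ℝ g (t, x) (0, EuclideanSpace.single j 1) := by
  have h : HasFDerivAt (fun y => g (t, y))
      ((fderiv ℝ g (t, x)).comp (ContinuousLinearMap.inr ℝ ℝ Space)) x :=
    (hg.differentiable one_ne_zero (t, x)).hasFDerivAt.comp x (hasFDerivAt_prodMk_right t x)
  rw [partialDeriv, h.fderiv]
  rfl

lemma contDiff_partialDeriv (hg : ContDiff ℝ (n + 1) g) (j : Fin 3) :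
    ContDiff ℝ n fun z : ℝ × Space => partialDeriv j (fun y => g (z.1, y)) z.2 := by
  have : (fun z : ℝ × Space => partialDeriv j (fun y => g (z.1, y)) z.2) =
      fun z => fderiv ℝ g z (0, EuclideanSpace.single j 1) := by
    funext z
    exact partialDeriv_slice (hg.of_le (by simp)) j z.1 z.2
  rw [this]
  exact (hg.fderiv_right le_rfl).clm_apply contDiff_const

lemma contDiff_deriv_time (hg : ContDiff ℝ (n + 1) g) :
    ContDiff ℝ n fun z : ℝ × Space => deriv (fun τ => g (τ, z.2)) z.1 := by
  have : (fun z : ℝ × Space => deriv (fun τ => g (τ, z.2)) z.1) =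
      fun z => fderiv ℝ g z (1, 0) := by
    funext z
    exact (hasDerivAt_time (hg.of_le (by simp)) z.1 z.2).deriv
  rw [this]
  exact (hg.fderiv_right le_rfl).clm_apply contDiff_const

end Slices

section Fields

variable {v w : ℝ → Space → Vec} {A : ℝ → Space → Tensor} {n : WithTop ℕ∞}

lemma VecC.mono {m : WithTop ℕ∞} (h : VecC n v) (hmn : m ≤ n) : VecC m v :=
  fun i => (h i).of_le hmn

lemma VecC.continuous (h : VecC n v) : Continuous fun z : ℝ × Space => v z.1 z.2 :=
  continuous_pi fun i => (h i).continuous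

lemma TensorC1.continuous (h : TensorC1 A) : Continuous fun z : ℝ × Space => A z.1 z.2 :=
  continuous_pi fun i => continuous_pi fun j => (h i j).continuous

lemma VecC.hasDerivAt_apply (h : VecC 1 v) (t : ℝ) (x : Space) (i : Fin 3) :
    HasDerivAt (fun τ => v τ x i) (deriv (fun τ => v τ x i) t) t :=
  (hasDerivAt_time (h i) t x).differentiableAt.hasDerivAt

lemma VecC.timeDeriv_apply (h : VecC 1 v) (t : ℝ) (x : Space) (i : Fin 3) :
    timeDeriv v t x i = deriv (fun τ => v τ x i) t := by
  rw [timeDeriv, deriv_pi fun i => (h.hasDerivAt_apply t x i).differentiableAt]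

lemma VecC.hasDerivAt (h : VecC 1 v) (t : ℝ) (x : Space) :
    HasDerivAt (fun τ => v τ x) (timeDeriv v t x) t :=
  (hasDerivAt_pi.2 fun i => h.hasDerivAt_apply t x i).differentiableAt.hasDerivAt

lemma VecC.timeDeriv (h : VecC (n + 1) v) : VecC n (timeDeriv v) := by
  intro i
  have : (fun z : ℝ × Space => Cosserat.timeDeriv v z.1 z.2 i) =
      fun z => deriv (fun τ => v τ z.2 i) z.1 :=
    funext fun z => (h.mono (by simp)).timeDeriv_apply z.1 z.2 i
  rw [this]
  exact contDiff_deriv_time (h i)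

lemma VecC.add (hv : VecC n v) (hw : VecC n w) : VecC n (v + w) :=
  fun i => (hv i).add (hw i)

lemma VecC.const_smul (hv : VecC n v) (c : ℝ) : VecC n (c • v) :=
  fun i => contDiff_const.mul (hv i)

lemma VecC.mulVec (hv : VecC n v) (J : Tensor) : VecC n fun t x => J *ᵥ v t x := by
  intro i
  simp only [Matrix.mulVec, dotProduct]
  exact ContDiff.sum fun j _ => contDiff_const.mul (hv j)

lemma timeDeriv_add_smul (hv : VecC 1 v) (hw : VecC 1 w) (c : ℝ) (t : ℝ) (x : Space) :
    timeDeriv (v + c • w) t x = timeDeriv v t x + c • timeDeriv w t x :=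
  ((hv.hasDerivAt t x).add ((hw.hasDerivAt t x).const_smul c)).deriv

lemma TensorC1.continuous_div (hA : TensorC1 A) :
    Continuous fun z : ℝ × Space => div (A z.1) z.2 := by
  refine continuous_pi fun i => continuous_finsetSum _ fun j _ => ?_
  exact (contDiff_partialDeriv (n := 0) (by simpa using hA i j) j).continuous

end Fields

/-! ### Integrals over space-time cylinders -/

/-- The measure `dv dt` on `[t₀, t₁] × B`. -/
noncomputable def spaceTimeMeasure (t₀ t₁ : ℝ) (B : Set Space) : Measure (ℝ × Space) :=
  ((volume : Measure ℝ).restrict (Icc t₀ t₁)).prod ((volume : Measure Space).restrict B)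

section Cylinder

variable {B G : Set Space} {t₀ t₁ : ℝ}

lemma spaceTimeMeasure_eq_restrict (t₀ t₁ : ℝ) (B : Set Space) :
    spaceTimeMeasure t₀ t₁ B = (volume : Measure (ℝ × Space)).restrict (Icc t₀ t₁ ×ˢ B) := by
  rw [spaceTimeMeasure, Measure.prod_restrict]
  rfl

lemma integrable_spaceTimeMeasure (hB : Bornology.IsBounded B) {g : ℝ × Space → ℝ}
    (hg : Continuous g) : Integrable g (spaceTimeMeasure t₀ t₁ B) := by
  rw [spaceTimeMeasure_eq_restrict]
  exact integrableOn_of_continuous_of_isBounded (Metric.isBounded_Icc t₀ t₁ |>.prod hB) hg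

lemma integral_spaceTimeMeasure (ht : t₀ ≤ t₁) (hB : Bornology.IsBounded B) {g : ℝ × Space → ℝ}
    (hg : Continuous g) :
    ∫ z, g z ∂spaceTimeMeasure t₀ t₁ B = ∫ t in t₀..t₁, ∫ x in B, g (t, x) := by
  rw [intervalIntegral.integral_of_le ht, ← integral_Icc_eq_integral_Ioc]
  exact integral_prod _ (integrable_spaceTimeMeasure hB hg)

lemma ae_mem_spaceTimeMeasure (hB : MeasurableSet B) :
    ∀ᵐ z ∂spaceTimeMeasure t₀ t₁ B, z.1 ∈ Icc t₀ t₁ ∧ z.2 ∈ B := by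
  rw [spaceTimeMeasure_eq_restrict]
  exact ae_restrict_mem (measurableSet_Icc.prod hB)

/-- A time derivative integrates to zero if the function vanishes initially and finally. -/
lemma integral_deriv_time_eq_zero (ht : t₀ ≤ t₁) (hB : Bornology.IsBounded B)
    {g : ℝ × Space → ℝ} (hg : ContDiff ℝ 1 g)
    (h₀ : ∀ x ∈ B, g (t₀, x) = 0) (h₁ : ∀ x ∈ B, g (t₁, x) = 0) :
    ∫ z : ℝ × Space, deriv (fun τ => g (τ, z.2)) z.1 ∂spaceTimeMeasure t₀ t₁ B = 0 := by
  have hc : Continuous fun z : ℝ × Space => deriv (fun τ => g (τ, z.2)) z.1 :=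
    (contDiff_deriv_time (n := 0) (by simpa using hg)).continuous
  have hi := integrable_spaceTimeMeasure (t₀ := t₀) (t₁ := t₁) hB hc
  rw [spaceTimeMeasure] at hi ⊢
  rw [integral_prod_symm _ hi]
  refine setIntegral_eq_zero_of_forall_eq_zero fun x hx => ?_
  simp only
  rw [integral_Icc_eq_integral_Ioc, ← intervalIntegral.integral_of_le ht,
    intervalIntegral.integral_deriv_eq_sub, h₀ x hx, h₁ x hx, sub_zero]
  · exact fun t _ => (hasDerivAt_time hg t x).differentiableAt
  · exact (hc.comp (by fun_prop : Continuous fun t : ℝ => (t, x))).intervalIntegrable _ _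

lemma isFiniteMeasure_surfaceMeasure_of_subset (hB : IsLipschitzBody B) (hG : G ⊆ frontier B) :
    IsFiniteMeasure (surfaceMeasure G) := by
  have := hB.isFiniteMeasure_surfaceMeasure
  exact isFiniteMeasure_of_le (surfaceMeasure (frontier B)) (Measure.restrict_mono_set _ hG)

lemma isFiniteMeasure_spaceTimeSurfaceMeasure (hB : IsLipschitzBody B) (hG : G ⊆ frontier B) :
    IsFiniteMeasure (spaceTimeSurfaceMeasure t₀ t₁ G) := by
  have := isFiniteMeasure_surfaceMeasure_of_subset hB hG
  unfold spaceTimeSurfaceMeasure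
  infer_instance

lemma ae_mem_spaceTimeSurfaceMeasure (hB : IsLipschitzBody B) (hGm : MeasurableSet G)
    (hG : G ⊆ frontier B) :
    ∀ᵐ z ∂spaceTimeSurfaceMeasure t₀ t₁ G, z.1 ∈ Icc t₀ t₁ ∧ z.2 ∈ G := by
  have := isFiniteMeasure_surfaceMeasure_of_subset hB hG
  rw [spaceTimeSurfaceMeasure]
  exact (Measure.quasiMeasurePreserving_fst.ae (ae_restrict_mem measurableSet_Icc)).and
    (Measure.quasiMeasurePreserving_snd.ae (ae_restrict_mem hGm))

lemma integral_spaceTimeSurfaceMeasure (ht : t₀ ≤ t₁) (hB : IsLipschitzBody B)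
    (hG : G ⊆ frontier B) {g : ℝ × Space → ℝ}
    (hg : Integrable g (spaceTimeSurfaceMeasure t₀ t₁ G)) :
    ∫ z, g z ∂spaceTimeSurfaceMeasure t₀ t₁ G =
      ∫ t in t₀..t₁, ∫ x, g (t, x) ∂surfaceMeasure G := by
  have := isFiniteMeasure_surfaceMeasure_of_subset hB hG
  rw [intervalIntegral.integral_of_le ht, ← integral_Icc_eq_integral_Ioc]
  exact integral_prod _ hg

lemma integrable_continuous_mul (hB : IsLipschitzBody B) (hGm : MeasurableSet G)
    (hG : G ⊆ frontier B) {a g : ℝ × Space → ℝ} (ha : Continuous a)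
    (hg : Integrable g (spaceTimeSurfaceMeasure t₀ t₁ G)) :
    Integrable (fun z => a z * g z) (spaceTimeSurfaceMeasure t₀ t₁ G) := by
  obtain ⟨C, hC⟩ := ((isCompact_Icc (a := t₀) (b := t₁)).prod
    hB.isCompact_closure).exists_bound_of_continuousOn ha.continuousOn
  refine hg.bdd_mul (c := C) ha.aestronglyMeasurable ?_
  filter_upwards [ae_mem_spaceTimeSurfaceMeasure hB hGm hG] with z hz
  exact hC z ⟨hz.1, frontier_subset_closure (hG hz.2)⟩

lemma integrable_of_continuous (hB : IsLipschitzBody B) (hGm : MeasurableSet G)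
    (hG : G ⊆ frontier B) {a : ℝ × Space → ℝ} (ha : Continuous a) :
    Integrable a (spaceTimeSurfaceMeasure t₀ t₁ G) := by
  have := isFiniteMeasure_spaceTimeSurfaceMeasure (t₀ := t₀) (t₁ := t₁) hB hG
  simpa using integrable_continuous_mul hB hGm hG ha (integrable_const (1 : ℝ))

lemma integrable_normal_mul (hB : IsLipschitzBody B) (hG : G ⊆ frontier B) {g : ℝ × Space → ℝ}
    (hg : Integrable g (spaceTimeSurfaceMeasure t₀ t₁ G)) (j : Fin 3) :
    Integrable (fun z => outwardNormal B z.2 j * g z) (spaceTimeSurfaceMeasure t₀ t₁ G) := by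
  have := isFiniteMeasure_surfaceMeasure_of_subset hB hG
  have hn : AEMeasurable (fun x => outwardNormal B x j) (surfaceMeasure G) :=
    (measurable_pi_apply j).comp_aemeasurable
      (hB.aemeasurable_outwardNormal.mono_measure (Measure.restrict_mono_set _ hG))
  refine hg.bdd_mul (c := 1) hn.comp_snd.aestronglyMeasurable ?_
  exact Filter.Eventually.of_forall fun z => abs_outwardNormal_le B z.2 j

/-- The divergence theorem integrated over time. -/
lemma integral_partialDeriv_spaceTime (ht : t₀ ≤ t₁) (hB : IsLipschitzBody B)
    {g : ℝ × Space → ℝ} (hg : ContDiff ℝ 1 g) (j : Fin 3) :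
    ∫ z : ℝ × Space, partialDeriv j (fun y => g (z.1, y)) z.2 ∂spaceTimeMeasure t₀ t₁ B =
      ∫ z : ℝ × Space, outwardNormal B z.2 j * g z
        ∂spaceTimeSurfaceMeasure t₀ t₁ (frontier B) := by
  rw [integral_spaceTimeMeasure ht hB.2.1
    (contDiff_partialDeriv (n := 0) (by simpa using hg) j).continuous,
    integral_spaceTimeSurfaceMeasure ht hB subset_rfl (integrable_normal_mul hB subset_rfl
      (integrable_of_continuous hB isClosed_frontier.measurableSet subset_rfl hg.continuous) j)]
  congr 1
  funext t
  simp only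
  rw [hB.setIntegral_partialDeriv (h := fun y => g (t, y))
    (hg.comp (contDiff_const.prodMk contDiff_id)) j]
  simp only [mul_comm]

/-- Surface integrals over the two parts of the boundary add up. -/
lemma integral_spaceTimeSurfaceMeasure_add_diff (hB : IsLipschitzBody B) (hGm : MeasurableSet G)
    (hG : G ⊆ frontier B) {g : ℝ × Space → ℝ}
    (hg : Integrable g (spaceTimeSurfaceMeasure t₀ t₁ (frontier B))) :
    ∫ z, g z ∂spaceTimeSurfaceMeasure t₀ t₁ (frontier B) =
      ∫ z, g z ∂spaceTimeSurfaceMeasure t₀ t₁ (frontier B \ G) +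
        ∫ z, g z ∂spaceTimeSurfaceMeasure t₀ t₁ G := by
  have hf1 := isFiniteMeasure_surfaceMeasure_of_subset hB hG
  have hf2 := isFiniteMeasure_surfaceMeasure_of_subset hB (sdiff_subset : frontier B \ G ⊆ _)
  have hsum : spaceTimeSurfaceMeasure t₀ t₁ (frontier B) =
      spaceTimeSurfaceMeasure t₀ t₁ (frontier B \ G) + spaceTimeSurfaceMeasure t₀ t₁ G := by
    rw [spaceTimeSurfaceMeasure, spaceTimeSurfaceMeasure, spaceTimeSurfaceMeasure,
      ← Measure.prod_add]
    congr 1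
    rw [surfaceMeasure, surfaceMeasure, surfaceMeasure,
      ← Measure.restrict_union disjoint_sdiff_left hGm, sdiff_union_of_subset hG]
  rw [hsum] at hg ⊢
  exact integral_add_measure hg.left_of_add_measure hg.right_of_add_measure

end Cylinder

/-! ### Densities of the functional -/

lemma ddot_eq_zero_of_self {A : Tensor} (h : ddot A A = 0) : A = 0 := by
  have h2 := (Finset.sum_eq_zero_iff_of_nonneg fun i _ =>
    Finset.sum_nonneg fun j _ => mul_self_nonneg (A i j)).1 h
  ext i j
  exact mul_self_eq_zero.1 ((Finset.sum_eq_zero_iff_of_nonneg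
    fun j _ => mul_self_nonneg (A i j)).1 (h2 i (Finset.mem_univ i)) j (Finset.mem_univ j))

lemma ddot_add_left (A B C : Tensor) : ddot (A + B) C = ddot A C + ddot B C := by
  simp [ddot, add_mul, Finset.sum_add_distrib]

lemma ddot_smul_left (c : ℝ) (A B : Tensor) : ddot (c • A) B = c * ddot A B := by
  simp [ddot, Finset.mul_sum, mul_assoc]

lemma ddot_comm (A B : Tensor) : ddot A B = ddot B A := by
  simp [ddot, mul_comm]

lemma ddot_add_right (A B C : Tensor) : ddot A (B + C) = ddot A B + ddot A C := by
  rw [ddot_comm, ddot_add_left, ddot_comm B, ddot_comm C]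

lemma ddot_smul_right (c : ℝ) (A B : Tensor) : ddot A (c • B) = c * ddot A B := by
  rw [ddot_comm, ddot_smul_left, ddot_comm B]

lemma ddot_sub_left (A B C : Tensor) : ddot (A - B) C = ddot A C - ddot B C := by
  simp [ddot, sub_mul, Finset.sum_sub_distrib]

lemma ddot_transpose_left (A B : Tensor) : ddot Aᵀ B = ddot A Bᵀ := by
  simp only [ddot, transpose_apply]
  exact Finset.sum_comm

lemma ddot_one_left (A : Tensor) : ddot 1 A = A.trace := by
  simp [ddot, Matrix.trace, Matrix.one_apply]

/-- The two contractions with the Levi-Civita symbol are adjoint up to sign. -/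
lemma ddot_epsVec (A : Tensor) (v : Vec) : ddot A (epsVec v) = -(epsTensor A ⬝ᵥ v) := by
  simp only [ddot, epsVec, epsTensor, leviCivita, dotProduct, Fin.sum_univ_three, Matrix.of_apply]
  simp
  ring

lemma continuous_ddot {X : Type*} [TopologicalSpace X] {A B : X → Tensor} (hA : Continuous A)
    (hB : Continuous B) : Continuous fun x => ddot (A x) (B x) := by
  unfold ddot
  exact continuous_finsetSum _ fun i _ => continuous_finsetSum _ fun j _ =>
    (hA.matrix_elem i j).mul (hB.matrix_elem i j)

namespace Moduli

lemma ddot_strainOfStress (m : Moduli) (A B : Tensor) :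
    ddot (m.strainOfStress A) B = (m.reciprocal.mu + m.reciprocal.alpha) * ddot A B
      + (m.reciprocal.mu - m.reciprocal.alpha) * ddot A Bᵀ
      + m.reciprocal.lam * A.trace * B.trace := by
  rw [strainOfStress, ddot_add_left, ddot_add_left, ddot_smul_left, ddot_smul_left,
    ddot_smul_left, ddot_transpose_left, ddot_one_left]

lemma ddot_torsionOfCouple (m : Moduli) (A B : Tensor) :
    ddot (m.torsionOfCouple A) B = (m.reciprocal.gamma + m.reciprocal.eps) * ddot A B
      + (m.reciprocal.gamma - m.reciprocal.eps) * ddot A Bᵀ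
      + m.reciprocal.beta * A.trace * B.trace := by
  rw [torsionOfCouple, ddot_add_left, ddot_add_left, ddot_smul_left, ddot_smul_left,
    ddot_smul_left, ddot_transpose_left, ddot_one_left]

/-- The inverse constitutive relations are the derivatives of the stress energy density. -/
lemma stressEnergyDensity_add_smul (m : Moduli) (σ τ σ' τ' : Tensor) (η : ℝ) :
    m.stressEnergyDensity (σ + η • σ') (τ + η • τ') = m.stressEnergyDensity σ τ
      + η * (ddot (m.strainOfStress σ) σ' + ddot (m.torsionOfCouple τ) τ')
      + η ^ 2 * m.stressEnergyDensity σ' τ' := by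
  rw [ddot_strainOfStress, ddot_torsionOfCouple]
  have h : ∀ A B : Tensor, ddot B Aᵀ = ddot A Bᵀ := fun A B => by
    rw [ddot_comm, ddot_transpose_left]
  simp only [stressEnergyDensity, ddot_add_left, ddot_add_right, ddot_smul_left, ddot_smul_right,
    transpose_add, transpose_smul, trace_add, trace_smul, smul_eq_mul, h σ σ', h τ τ',
    ddot_comm σ' σ, ddot_comm τ' τ]
  ring

lemma continuous_stressEnergyDensity (m : Moduli) {X : Type*} [TopologicalSpace X]
    {A B : X → Tensor} (hA : Continuous A) (hB : Continuous B) :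
    Continuous fun x => m.stressEnergyDensity (A x) (B x) := by
  unfold stressEnergyDensity
  have h1 := continuous_ddot hA hA
  have h2 := continuous_ddot hA hA.matrix_transpose
  have h3 := hA.matrix_trace
  have h4 := continuous_ddot hB hB
  have h5 := continuous_ddot hB hB.matrix_transpose
  have h6 := hB.matrix_trace
  fun_prop

lemma continuous_strainOfStress (m : Moduli) {X : Type*} [TopologicalSpace X]
    {A : X → Tensor} (hA : Continuous A) : Continuous fun x => m.strainOfStress (A x) := by
  unfold strainOfStress
  have h2 := hA.matrix_transpose
  have h3 := hA.matrix_trace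
  fun_prop

lemma continuous_torsionOfCouple (m : Moduli) {X : Type*} [TopologicalSpace X]
    {A : X → Tensor} (hA : Continuous A) : Continuous fun x => m.torsionOfCouple (A x) := by
  unfold torsionOfCouple
  have h2 := hA.matrix_transpose
  have h3 := hA.matrix_trace
  fun_prop

end Moduli

/-- States whose fields have the smoothness required of admissible states. -/
structure State.Smooth (s : State) : Prop where
  disp : VecC 2 s.disp
  rot : VecC 2 s.rot
  strain : TensorC1 s.strain
  torsion : TensorC1 s.torsion
  stress : TensorC1 s.stress
  couple : TensorC1 s.couple

lemma TensorC1.add_smul {A A' : ℝ → Space → Tensor} (hA : TensorC1 A) (hA' : TensorC1 A') (c : ℝ) :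
    TensorC1 (A + c • A') :=
  fun i j => (hA i j).add (contDiff_const.mul (hA' i j))

namespace State

variable {s δs : State} {B : Set Space} {t₀ t₁ : ℝ}

lemma Admissible.smooth (h : s.Admissible B t₀ t₁) : s.Smooth :=
  ⟨h.disp_smooth, h.rot_smooth, h.strain_smooth, h.torsion_smooth, h.stress_smooth,
    h.couple_smooth⟩

lemma Smooth.perturb (h : s.Smooth) (h' : δs.Smooth) (η : ℝ) : (s.perturb δs η).Smooth :=
  ⟨h.disp.add (h'.disp.const_smul η), h.rot.add (h'.rot.const_smul η),
    h.strain.add_smul h'.strain η, h.torsion.add_smul h'.torsion η,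
    h.stress.add_smul h'.stress η, h.couple.add_smul h'.couple η⟩

lemma Smooth.velocity (h : s.Smooth) : VecC 1 s.velocity :=
  VecC.timeDeriv (n := 1) (by simpa [one_add_one_eq_two] using h.disp)

lemma Smooth.spin (h : s.Smooth) : VecC 1 s.spin :=
  VecC.timeDeriv (n := 1) (by simpa [one_add_one_eq_two] using h.rot)

lemma Smooth.linMomentum (h : s.Smooth) (ρ : ℝ) : VecC 1 (s.linMomentum ρ) :=
  h.velocity.const_smul ρ

lemma Smooth.angMomentum (h : s.Smooth) (J : Tensor) : VecC 1 (s.angMomentum J) :=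
  h.spin.mulVec J

lemma Smooth.velocity_perturb (h : s.Smooth) (h' : δs.Smooth) (η t : ℝ) (x : Space) :
    (s.perturb δs η).velocity t x = s.velocity t x + η • δs.velocity t x :=
  timeDeriv_add_smul (h.disp.mono one_le_two) (h'.disp.mono one_le_two) η t x

lemma Smooth.spin_perturb (h : s.Smooth) (h' : δs.Smooth) (η t : ℝ) (x : Space) :
    (s.perturb δs η).spin t x = s.spin t x + η • δs.spin t x :=
  timeDeriv_add_smul (h.rot.mono one_le_two) (h'.rot.mono one_le_two) η t x

end State

namespace Problem

/-- The integrand of the volume terms of the functional. -/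
noncomputable def bulkDensity (P : Problem) (s : State) (z : ℝ × Space) : ℝ :=
  P.moduli.stressEnergyDensity (s.stress z.1 z.2) (s.couple z.1 z.2)
    - 1 / 2 * (P.ρ * (s.velocity z.1 z.2 ⬝ᵥ s.velocity z.1 z.2)
      + s.spin z.1 z.2 ⬝ᵥ (P.J *ᵥ s.spin z.1 z.2))
    + (-(ddot (s.stress z.1 z.2) (s.strain z.1 z.2) + ddot (s.couple z.1 z.2) (s.torsion z.1 z.2))
      + s.linMomentum P.ρ z.1 z.2 ⬝ᵥ s.velocity z.1 z.2
      + s.angMomentum P.J z.1 z.2 ⬝ᵥ s.spin z.1 z.2)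

/-- The boundary integrand on the displacement part. -/
noncomputable def dispDensity (P : Problem) (s : State) (z : ℝ × Space) : ℝ :=
  (s.stress z.1 z.2 *ᵥ P.normal z.2) ⬝ᵥ (s.disp z.1 z.2 - P.u₀ z.1 z.2)
    + (s.couple z.1 z.2 *ᵥ P.normal z.2) ⬝ᵥ (s.rot z.1 z.2 - P.φ₀ z.1 z.2)

/-- The boundary integrand on the traction part. -/
noncomputable def tractionDensity (P : Problem) (s : State) (z : ℝ × Space) : ℝ :=
  P.σ₀ z.1 z.2 ⬝ᵥ s.disp z.1 z.2 + P.μ₀ z.1 z.2 ⬝ᵥ s.rot z.1 z.2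

/-- The pairing of the stresses of `s` with the displacements of `δs` on the boundary. -/
noncomputable def boundaryWork (P : Problem) (s δs : State) (z : ℝ × Space) : ℝ :=
  (s.stress z.1 z.2 *ᵥ P.normal z.2) ⬝ᵥ δs.disp z.1 z.2
    + (s.couple z.1 z.2 *ᵥ P.normal z.2) ⬝ᵥ δs.rot z.1 z.2

/-- The first variation of `bulkDensity` at `s` in direction `δs`. -/
noncomputable def bulkVariation (P : Problem) (s δs : State) (z : ℝ × Space) : ℝ :=
  ddot (P.moduli.strainOfStress (s.stress z.1 z.2) - s.strain z.1 z.2) (δs.stress z.1 z.2)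
    + ddot (P.moduli.torsionOfCouple (s.couple z.1 z.2) - s.torsion z.1 z.2) (δs.couple z.1 z.2)
    - ddot (s.stress z.1 z.2) (δs.strain z.1 z.2) - ddot (s.couple z.1 z.2) (δs.torsion z.1 z.2)
    + s.linMomentum P.ρ z.1 z.2 ⬝ᵥ δs.velocity z.1 z.2
    + s.angMomentum P.J z.1 z.2 ⬝ᵥ δs.spin z.1 z.2

variable {P : Problem} {s δs : State}

/-- The volume integrand is quadratic. Symmetry of the inertia tensor enters here. -/
lemma bulkDensity_perturb (hJ : P.J.IsSymm) (h : s.Smooth) (h' : δs.Smooth) (η : ℝ)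
    (z : ℝ × Space) :
    P.bulkDensity (s.perturb δs η) z =
      P.bulkDensity s z + η * P.bulkVariation s δs z + η ^ 2 * P.bulkDensity δs z := by
  have hsymm : ∀ a b : Vec, b ⬝ᵥ (P.J *ᵥ a) = a ⬝ᵥ (P.J *ᵥ b) := fun a b => by
    rw [dotProduct_mulVec, ← mulVec_transpose, hJ.eq, dotProduct_comm]
  simp only [bulkDensity, bulkVariation, State.linMomentum, State.angMomentum,
    h.velocity_perturb h', h.spin_perturb h']
  simp only [State.perturb, Pi.add_apply, Pi.smul_apply]
  rw [P.moduli.stressEnergyDensity_add_smul]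
  simp only [ddot_add_left, ddot_add_right, ddot_smul_left, ddot_smul_right, ddot_sub_left,
    mulVec_add, mulVec_smul, dotProduct_add, add_dotProduct, dotProduct_smul, smul_dotProduct,
    smul_eq_mul, dotProduct_comm (P.J *ᵥ _), hsymm (s.spin z.1 z.2) (δs.spin z.1 z.2),
    dotProduct_comm (δs.velocity z.1 z.2) (s.velocity z.1 z.2),
    ddot_comm (s.strain z.1 z.2), ddot_comm (s.torsion z.1 z.2)]
  ring

lemma dispDensity_perturb (η : ℝ) (z : ℝ × Space) :
    P.dispDensity (s.perturb δs η) z = P.dispDensity s z +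
      η * (P.dispDensity { s with stress := δs.stress, couple := δs.couple } z
        + P.boundaryWork s δs z) + η ^ 2 * P.boundaryWork δs δs z := by
  simp only [dispDensity, boundaryWork, State.perturb, Pi.add_apply, Pi.smul_apply,
    add_mulVec, smul_mulVec, add_dotProduct, smul_dotProduct, dotProduct_add, dotProduct_sub,
    dotProduct_smul, smul_eq_mul]
  ring

lemma tractionDensity_perturb (η : ℝ) (z : ℝ × Space) :
    P.tractionDensity (s.perturb δs η) z =
      P.tractionDensity s z + η * P.tractionDensity δs z := by
  simp only [tractionDensity, State.perturb, Pi.add_apply, Pi.smul_apply, dotProduct_add,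
    dotProduct_smul, smul_eq_mul]
  ring

lemma continuous_bulkDensity (h : s.Smooth) : Continuous (P.bulkDensity s) := by
  have h1 := P.moduli.continuous_stressEnergyDensity h.stress.continuous h.couple.continuous
  have hv := h.velocity.continuous
  have hw := h.spin.continuous
  have h2 := hv.dotProduct hv
  have h3 := hw.dotProduct ((h.spin.mulVec P.J).continuous)
  have h4 := continuous_ddot h.stress.continuous h.strain.continuous
  have h5 := continuous_ddot h.couple.continuous h.torsion.continuous
  have h6 := (h.linMomentum P.ρ).continuous.dotProduct hv
  have h7 := (h.angMomentum P.J).continuous.dotProduct hw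
  unfold bulkDensity
  fun_prop

lemma continuous_bulkVariation (h : s.Smooth) (h' : δs.Smooth) :
    Continuous (P.bulkVariation s δs) := by
  have h1 := continuous_ddot ((P.moduli.continuous_strainOfStress h.stress.continuous).sub
    h.strain.continuous) h'.stress.continuous
  have h2 := continuous_ddot ((P.moduli.continuous_torsionOfCouple h.couple.continuous).sub
    h.torsion.continuous) h'.couple.continuous
  have h4 := continuous_ddot h.stress.continuous h'.strain.continuous
  have h5 := continuous_ddot h.couple.continuous h'.torsion.continuous
  have h6 := (h.linMomentum P.ρ).continuous.dotProduct h'.velocity.continuous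
  have h7 := (h.angMomentum P.J).continuous.dotProduct h'.spin.continuous
  unfold bulkVariation
  fun_prop

lemma dispPart_subset (P : Problem) : P.dispPart ⊆ frontier P.body := sdiff_subset

lemma StandingAssumptions.measurable_dispPart (hP : P.StandingAssumptions) :
    MeasurableSet P.dispPart :=
  isClosed_frontier.measurableSet.diff hP.tractionPart_measurable

end Problem

namespace Problem

variable {P : Problem} {s δs : State}

/-! ### The first variation of the functional -/

section BoundaryIntegrability

variable {G : Set Space}

lemma integrable_dotProduct (hB : IsLipschitzBody P.body) (hGm : MeasurableSet G)
    (hG : G ⊆ frontier P.body) {v : ℝ × Space → Vec} (hv : Continuous v) {w : ℝ × Space → Vec}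
    (hw : Integrable w (spaceTimeSurfaceMeasure P.t₀ P.t₁ G)) :
    Integrable (fun z => v z ⬝ᵥ w z) (spaceTimeSurfaceMeasure P.t₀ P.t₁ G) := by
  unfold dotProduct
  exact integrable_finsetSum _ fun i _ =>
    integrable_continuous_mul hB hGm hG ((continuous_apply i).comp hv) (hw.eval i)

lemma integrable_traction_dotProduct (hB : IsLipschitzBody P.body) (hGm : MeasurableSet G)
    (hG : G ⊆ frontier P.body) {A : ℝ × Space → Tensor} (hA : Continuous A) {w : ℝ × Space → Vec}
    (hw : Integrable w (spaceTimeSurfaceMeasure P.t₀ P.t₁ G)) :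
    Integrable (fun z => (A z *ᵥ P.normal z.2) ⬝ᵥ w z) (spaceTimeSurfaceMeasure P.t₀ P.t₁ G) := by
  simp only [mulVec, dotProduct, Finset.sum_mul]
  refine integrable_finsetSum _ fun i _ => integrable_finsetSum _ fun j _ => ?_
  refine (integrable_continuous_mul hB hGm hG (hA.matrix_elem i j)
    (integrable_normal_mul hB hG (hw.eval i) j)).congr (Filter.Eventually.of_forall fun z => ?_)
  simp only [normal, mul_assoc]

lemma integrable_continuous_vec (hB : IsLipschitzBody P.body) (hGm : MeasurableSet G)
    (hG : G ⊆ frontier P.body) {v : ℝ × Space → Vec} (hv : Continuous v) :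
    Integrable v (spaceTimeSurfaceMeasure P.t₀ P.t₁ G) :=
  Integrable.of_eval fun i => integrable_of_continuous hB hGm hG ((continuous_apply i).comp hv)

lemma integrable_boundaryWork (hB : IsLipschitzBody P.body) (hGm : MeasurableSet G)
    (hG : G ⊆ frontier P.body) (h : s.Smooth) (h' : δs.Smooth) :
    Integrable (P.boundaryWork s δs) (spaceTimeSurfaceMeasure P.t₀ P.t₁ G) :=
  (integrable_traction_dotProduct hB hGm hG h.stress.continuous
    (integrable_continuous_vec hB hGm hG h'.disp.continuous)).add
  (integrable_traction_dotProduct hB hGm hG h.couple.continuous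
    (integrable_continuous_vec hB hGm hG h'.rot.continuous))

end BoundaryIntegrability

namespace StandingAssumptions

lemma integrable_dispDensity (hP : P.StandingAssumptions) (h : s.Smooth) :
    Integrable (P.dispDensity s) (spaceTimeSurfaceMeasure P.t₀ P.t₁ P.dispPart) :=
  (integrable_traction_dotProduct hP.body_lipschitz hP.measurable_dispPart P.dispPart_subset
    h.stress.continuous ((integrable_continuous_vec hP.body_lipschitz hP.measurable_dispPart
      P.dispPart_subset h.disp.continuous).sub hP.u₀_integrable)).add
  (integrable_traction_dotProduct hP.body_lipschitz hP.measurable_dispPart P.dispPart_subset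
    h.couple.continuous ((integrable_continuous_vec hP.body_lipschitz hP.measurable_dispPart
      P.dispPart_subset h.rot.continuous).sub hP.φ₀_integrable))

lemma integrable_tractionDensity (hP : P.StandingAssumptions) (h : s.Smooth) :
    Integrable (P.tractionDensity s) (spaceTimeSurfaceMeasure P.t₀ P.t₁ P.tractionPart) := by
  have h1 := integrable_dotProduct hP.body_lipschitz hP.tractionPart_measurable
    hP.tractionPart_subset h.disp.continuous hP.σ₀_integrable
  have h2 := integrable_dotProduct hP.body_lipschitz hP.tractionPart_measurable
    hP.tractionPart_subset h.rot.continuous hP.μ₀_integrable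
  refine (h1.add h2).congr (Filter.Eventually.of_forall fun z => ?_)
  simp only [Pi.add_apply, tractionDensity, dotProduct_comm]

/-- The functional as a sum of three space-time integrals. -/
lemma functional_eq (hP : P.StandingAssumptions) (h : s.Smooth) :
    P.functional s = ∫ z, P.bulkDensity s z ∂spaceTimeMeasure P.t₀ P.t₁ P.body
      + ∫ z, P.dispDensity s z ∂spaceTimeSurfaceMeasure P.t₀ P.t₁ P.dispPart
      + ∫ z, P.tractionDensity s z ∂spaceTimeSurfaceMeasure P.t₀ P.t₁ P.tractionPart := by
  have hB := hP.body_lipschitz.2.1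
  have ht := hP.time_lt.le
  have hΦ := P.moduli.continuous_stressEnergyDensity h.stress.continuous h.couple.continuous
  have hv := h.velocity.continuous
  have hw := h.spin.continuous
  have h2 := hv.dotProduct hv
  have h3 := hw.dotProduct ((h.spin.mulVec P.J).continuous)
  have h4 := continuous_ddot h.stress.continuous h.strain.continuous
  have h5 := continuous_ddot h.couple.continuous h.torsion.continuous
  have h6 := (h.linMomentum P.ρ).continuous.dotProduct hv
  have h7 := (h.angMomentum P.J).continuous.dotProduct hw
  have hK : Continuous fun z : ℝ × Space => P.ρ * (s.velocity z.1 z.2 ⬝ᵥ s.velocity z.1 z.2)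
      + s.spin z.1 z.2 ⬝ᵥ (P.J *ᵥ s.spin z.1 z.2) := by fun_prop
  have hW : Continuous fun z : ℝ × Space =>
      -(ddot (s.stress z.1 z.2) (s.strain z.1 z.2) + ddot (s.couple z.1 z.2) (s.torsion z.1 z.2))
      + s.linMomentum P.ρ z.1 z.2 ⬝ᵥ s.velocity z.1 z.2
      + s.angMomentum P.J z.1 z.2 ⬝ᵥ s.spin z.1 z.2 := by fun_prop
  have slice : ∀ {g : ℝ × Space → ℝ}, Continuous g → ∀ t,
      IntegrableOn (fun x => g (t, x)) P.body := fun hg t =>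
    integrableOn_of_continuous_of_isBounded hB (hg.comp (by fun_prop))
  have e1 : ∀ t, P.stressEnergy s t - P.kineticEnergy s t = ∫ x in P.body,
      (P.moduli.stressEnergyDensity (s.stress t x) (s.couple t x)
        - 1 / 2 * (P.ρ * (s.velocity t x ⬝ᵥ s.velocity t x)
          + s.spin t x ⬝ᵥ (P.J *ᵥ s.spin t x))) := by
    intro t
    rw [stressEnergy, kineticEnergy, ← integral_const_mul]
    exact (integral_sub (slice hΦ t) ((slice hK t).const_mul _)).symm
  have hΦK : Continuous fun z : ℝ × Space =>
      P.moduli.stressEnergyDensity (s.stress z.1 z.2) (s.couple z.1 z.2)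
        - 1 / 2 * (P.ρ * (s.velocity z.1 z.2 ⬝ᵥ s.velocity z.1 z.2)
          + s.spin z.1 z.2 ⬝ᵥ (P.J *ᵥ s.spin z.1 z.2)) := hΦ.sub (continuous_const.mul hK)
  rw [functional]
  simp only [e1, work, dispBoundaryTerm, tractionBoundaryTerm]
  have i1 := integral_spaceTimeMeasure ht hB hΦK
  have i2 := integral_spaceTimeMeasure ht hB hW
  have i3 := integral_spaceTimeSurfaceMeasure ht hP.body_lipschitz P.dispPart_subset
    (hP.integrable_dispDensity h)
  have i4 := integral_spaceTimeSurfaceMeasure ht hP.body_lipschitz hP.tractionPart_subset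
    (hP.integrable_tractionDensity h)
  rw [i3, i4, ← i1, ← i2]
  simp only [bulkDensity]
  rw [integral_add (integrable_spaceTimeMeasure hB hΦK) (integrable_spaceTimeMeasure hB hW)]
  rfl

end StandingAssumptions

/-- The first variation of the functional at `s` in direction `δs`. -/
noncomputable def firstVariation (P : Problem) (s δs : State) : ℝ :=
  ∫ z, P.bulkVariation s δs z ∂spaceTimeMeasure P.t₀ P.t₁ P.body
    + ∫ z, (P.dispDensity { s with stress := δs.stress, couple := δs.couple } z
        + P.boundaryWork s δs z) ∂spaceTimeSurfaceMeasure P.t₀ P.t₁ P.dispPart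
    + ∫ z, P.tractionDensity δs z ∂spaceTimeSurfaceMeasure P.t₀ P.t₁ P.tractionPart

lemma smooth_withStress (h : s.Smooth) (h' : δs.Smooth) :
    State.Smooth { s with stress := δs.stress, couple := δs.couple } :=
  ⟨h.disp, h.rot, h.strain, h.torsion, h'.stress, h'.couple⟩

lemma integral_quadratic {X : Type*} [MeasurableSpace X] {μ : Measure X} {a b c : X → ℝ}
    (ha : Integrable a μ) (hb : Integrable b μ) (hc : Integrable c μ) (η : ℝ) :
    ∫ x, (a x + η * b x + η ^ 2 * c x) ∂μ =
      ∫ x, a x ∂μ + η * ∫ x, b x ∂μ + η ^ 2 * ∫ x, c x ∂μ := by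
  have hab : Integrable (fun x => a x + η * b x) μ := ha.add (hb.const_mul η)
  rw [integral_add hab (hc.const_mul _), integral_add ha (hb.const_mul η),
    integral_const_mul, integral_const_mul]

/-- Along a line of states the functional is a quadratic polynomial with linear coefficient
`firstVariation`. -/
lemma StandingAssumptions.hasDerivAt_functional (hP : P.StandingAssumptions) (h : s.Smooth)
    (h' : δs.Smooth) :
    HasDerivAt (fun η : ℝ => P.functional (s.perturb δs η)) (P.firstVariation s δs) 0 := by
  have hB := hP.body_lipschitz
  have hdm := hP.measurable_dispPart
  have hds := P.dispPart_subset
  obtain ⟨a, c, hac⟩ : ∃ a c : ℝ, ∀ η, P.functional (s.perturb δs η) =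
      a + η * P.firstVariation s δs + η ^ 2 * c := by
    refine ⟨∫ z, P.bulkDensity s z ∂spaceTimeMeasure P.t₀ P.t₁ P.body
        + ∫ z, P.dispDensity s z ∂spaceTimeSurfaceMeasure P.t₀ P.t₁ P.dispPart
        + ∫ z, P.tractionDensity s z ∂spaceTimeSurfaceMeasure P.t₀ P.t₁ P.tractionPart,
      ∫ z, P.bulkDensity δs z ∂spaceTimeMeasure P.t₀ P.t₁ P.body
        + ∫ z, P.boundaryWork δs δs z ∂spaceTimeSurfaceMeasure P.t₀ P.t₁ P.dispPart,
      fun η => ?_⟩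
    have hvar : Integrable (fun z =>
        P.dispDensity { s with stress := δs.stress, couple := δs.couple } z
          + P.boundaryWork s δs z) (spaceTimeSurfaceMeasure P.t₀ P.t₁ P.dispPart) :=
      (hP.integrable_dispDensity (smooth_withStress h h')).add
        (integrable_boundaryWork hB hdm hds h h')
    rw [hP.functional_eq (h.perturb h' η)]
    simp only [bulkDensity_perturb hP.inertia_symm h h', dispDensity_perturb,
      tractionDensity_perturb]
    rw [integral_quadratic (integrable_spaceTimeMeasure hB.2.1 (continuous_bulkDensity h))
        (integrable_spaceTimeMeasure hB.2.1 (continuous_bulkVariation h h'))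
        (integrable_spaceTimeMeasure hB.2.1 (continuous_bulkDensity h')),
      integral_quadratic (hP.integrable_dispDensity h) hvar
        (integrable_boundaryWork hB hdm hds h' h'),
      integral_add (hP.integrable_tractionDensity h)
        ((hP.integrable_tractionDensity h').const_mul η), integral_const_mul, firstVariation]
    ring
  simp only [hac]
  have := (((hasDerivAt_id' (0 : ℝ)).mul_const (P.firstVariation s δs)).const_add a).fun_add
    (((hasDerivAt_id' (0 : ℝ)).fun_pow 2).mul_const c)
  simpa using this

/-- Stationarity means that the first variation vanishes. -/
lemma StandingAssumptions.stationary_iff (hP : P.StandingAssumptions) (h : s.Smooth) :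
    P.Stationary s ↔ ∀ δs : State, δs.IsVariation P.body P.t₀ P.t₁ P.ρ P.J →
      P.firstVariation s δs = 0 := by
  refine forall₂_congr fun δs hδ => ?_
  have hd := hP.hasDerivAt_functional h hδ.admissible.smooth
  exact ⟨fun h0 => hd.unique h0, fun h0 => h0 ▸ hd⟩

/-! ### Integration by parts -/

lemma hasDerivAt_dotProduct {v w : ℝ → Space → Vec} (hv : VecC 1 v) (hw : VecC 1 w) (t : ℝ)
    (x : Space) :
    HasDerivAt (fun τ => v τ x ⬝ᵥ w τ x)
      (timeDeriv v t x ⬝ᵥ w t x + v t x ⬝ᵥ timeDeriv w t x) t := by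
  simp only [dotProduct, ← Finset.sum_add_distrib]
  exact HasDerivAt.fun_sum fun i _ =>
    (hasDerivAt_pi.1 (hv.hasDerivAt t x) i).mul (hasDerivAt_pi.1 (hw.hasDerivAt t x) i)

lemma contDiff_dotProduct {v w : ℝ → Space → Vec} (hv : VecC 1 v) (hw : VecC 1 w) :
    ContDiff ℝ 1 fun z : ℝ × Space => v z.1 z.2 ⬝ᵥ w z.1 z.2 :=
  ContDiff.sum fun i _ => (hv i).mul (hw i)

/-- The divergence of the vector field `Aᵀ v`. -/
lemma sum_partialDeriv_contract {A : ℝ → Space → Tensor} (hA : TensorC1 A) {v : ℝ → Space → Vec}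
    (hv : VecC 1 v) (t : ℝ) (x : Space) :
    ∑ j, partialDeriv j (fun y => ∑ i, A t y i j * v t y i) x =
      div (A t) x ⬝ᵥ v t x + ddot (A t x) (grad (v t) x)ᵀ := by
  have hslice : ∀ {g : ℝ × Space → ℝ}, ContDiff ℝ 1 g → DifferentiableAt ℝ (fun y => g (t, y)) x :=
    fun hg => (hg.comp (contDiff_const.prodMk contDiff_id)).differentiable one_ne_zero x
  have h1 : ∀ j, partialDeriv j (fun y => ∑ i, A t y i j * v t y i) x =
      ∑ i, (A t x i j * partialDeriv j (fun y => v t y i) x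
        + v t x i * partialDeriv j (fun y => A t y i j) x) := by
    intro j
    have hAd : ∀ i, DifferentiableAt ℝ (fun y => A t y i j) x := fun i => hslice (hA i j)
    have hvd : ∀ i, DifferentiableAt ℝ (fun y => v t y i) x := fun i => hslice (hv i)
    simp only [partialDeriv]
    rw [fderiv_fun_sum fun i _ => (hAd i).fun_mul (hvd i)]
    simp only [_root_.sum_apply]
    refine Finset.sum_congr rfl fun i _ => ?_
    rw [fderiv_fun_mul (hAd i) (hvd i)]
    simp
  simp only [h1, div, dotProduct, ddot, grad, transpose_apply, of_apply, Finset.sum_mul]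
  rw [Finset.sum_comm, ← Finset.sum_add_distrib]
  refine Finset.sum_congr rfl fun i _ => ?_
  rw [← Finset.sum_add_distrib]
  exact Finset.sum_congr rfl fun j _ => by ring

/-- The divergence theorem for `Aᵀ v`, integrated over time. -/
lemma integral_div_contract (hP : P.StandingAssumptions) {A : ℝ → Space → Tensor} (hA : TensorC1 A)
    {v : ℝ → Space → Vec} (hv : VecC 1 v) :
    ∫ z : ℝ × Space, (div (A z.1) z.2 ⬝ᵥ v z.1 z.2 + ddot (A z.1 z.2) (grad (v z.1) z.2)ᵀ)
        ∂spaceTimeMeasure P.t₀ P.t₁ P.body =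
      ∫ z : ℝ × Space, (A z.1 z.2 *ᵥ P.normal z.2) ⬝ᵥ v z.1 z.2
        ∂spaceTimeSurfaceMeasure P.t₀ P.t₁ (frontier P.body) := by
  have hg : ∀ j, ContDiff ℝ 1 fun z : ℝ × Space => ∑ i, A z.1 z.2 i j * v z.1 z.2 i := fun j =>
    ContDiff.sum fun i _ => (hA i j).mul (hv i)
  have hB := hP.body_lipschitz
  simp only [← sum_partialDeriv_contract hA hv]
  rw [integral_finsetSum]
  · have h2 : ∀ j, ∫ z : ℝ × Space, partialDeriv j (fun y => ∑ i, A z.1 y i j * v z.1 y i) z.2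
          ∂spaceTimeMeasure P.t₀ P.t₁ P.body =
        ∫ z : ℝ × Space, outwardNormal P.body z.2 j * ∑ i, A z.1 z.2 i j * v z.1 z.2 i
          ∂spaceTimeSurfaceMeasure P.t₀ P.t₁ (frontier P.body) := fun j =>
      integral_partialDeriv_spaceTime hP.time_lt.le hB (hg j) j
    simp only [h2]
    rw [← integral_finsetSum]
    · congr 1
      funext z
      simp only [mulVec, dotProduct, Finset.sum_mul, Finset.mul_sum, normal]
      rw [Finset.sum_comm]
      exact Finset.sum_congr rfl fun i _ => Finset.sum_congr rfl fun j _ => by ring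
    · exact fun j _ => integrable_normal_mul hB subset_rfl (integrable_of_continuous hB
        isClosed_frontier.measurableSet subset_rfl (hg j).continuous) j
  · exact fun j _ => integrable_spaceTimeMeasure hB.2.1
      (contDiff_partialDeriv (n := 0) (by simpa using hg j) j).continuous

/-- The volume integrand of the weak form: the residuals of the constitutive relations and of the
balance laws, tested with a variation. -/
noncomputable def residualWork (P : Problem) (s δs : State) (z : ℝ × Space) : ℝ :=
  ddot (P.moduli.strainOfStress (s.stress z.1 z.2) - s.strain z.1 z.2) (δs.stress z.1 z.2)
    + ddot (P.moduli.torsionOfCouple (s.couple z.1 z.2) - s.torsion z.1 z.2) (δs.couple z.1 z.2)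
    + (div (s.stress z.1) z.2 - timeDeriv (s.linMomentum P.ρ) z.1 z.2) ⬝ᵥ δs.disp z.1 z.2
    + (epsTensor (s.stress z.1 z.2) + div (s.couple z.1) z.2
        - timeDeriv (s.angMomentum P.J) z.1 z.2) ⬝ᵥ δs.rot z.1 z.2

/-- The boundary integrand of the weak form on the traction part. -/
noncomputable def tractionResidual (P : Problem) (s δs : State) (z : ℝ × Space) : ℝ :=
  P.tractionDensity δs z - P.boundaryWork s δs z

lemma continuous_epsTensor {X : Type*} [TopologicalSpace X] {A : X → Tensor} (hA : Continuous A) :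
    Continuous fun x => epsTensor (A x) :=
  continuous_pi fun _ => continuous_finsetSum _ fun j _ => continuous_finsetSum _ fun k _ =>
    continuous_const.mul (hA.matrix_elem k j)

lemma continuous_residualWork (h : s.Smooth) (h' : δs.Smooth) :
    Continuous (P.residualWork s δs) := by
  have h1 := continuous_ddot ((P.moduli.continuous_strainOfStress h.stress.continuous).sub
    h.strain.continuous) h'.stress.continuous
  have h2 := continuous_ddot ((P.moduli.continuous_torsionOfCouple h.couple.continuous).sub
    h.torsion.continuous) h'.couple.continuous
  have hp : VecC 0 (timeDeriv (s.linMomentum P.ρ)) :=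
    VecC.timeDeriv (n := 0) (by simpa using h.linMomentum P.ρ)
  have hq : VecC 0 (timeDeriv (s.angMomentum P.J)) :=
    VecC.timeDeriv (n := 0) (by simpa using h.angMomentum P.J)
  have h3 := (h.stress.continuous_div.sub hp.continuous).dotProduct h'.disp.continuous
  have h4 := (((continuous_epsTensor h.stress.continuous).add h.couple.continuous_div).sub
    hq.continuous).dotProduct h'.rot.continuous
  unfold residualWork
  fun_prop

/-- Where the variation is kinematically admissible, the varied volume integrand differs from the
residual work by a time derivative and a divergence. -/
lemma bulkVariation_eq (h : s.Smooth) (h' : δs.Smooth) {z : ℝ × Space}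
    (hk : δs.KinematicAt z.1 z.2) :
    P.bulkVariation s δs z = P.residualWork s δs z
      + deriv (fun τ => s.linMomentum P.ρ τ z.2 ⬝ᵥ δs.disp τ z.2
          + s.angMomentum P.J τ z.2 ⬝ᵥ δs.rot τ z.2) z.1
      - (div (s.stress z.1) z.2 ⬝ᵥ δs.disp z.1 z.2
          + ddot (s.stress z.1 z.2) (grad (δs.disp z.1) z.2)ᵀ)
      - (div (s.couple z.1) z.2 ⬝ᵥ δs.rot z.1 z.2
          + ddot (s.couple z.1 z.2) (grad (δs.rot z.1) z.2)ᵀ) := by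
  have hd := (hasDerivAt_dotProduct (h.linMomentum P.ρ) (h'.disp.mono one_le_two) z.1 z.2).add
    (hasDerivAt_dotProduct (h.angMomentum P.J) (h'.rot.mono one_le_two) z.1 z.2)
  have hd' : deriv (fun τ => s.linMomentum P.ρ τ z.2 ⬝ᵥ δs.disp τ z.2
      + s.angMomentum P.J τ z.2 ⬝ᵥ δs.rot τ z.2) z.1 = _ := hd.deriv
  rw [hd', bulkVariation, residualWork, hk.1, hk.2, ddot_add_right, ddot_epsVec]
  simp only [sub_dotProduct, add_dotProduct]
  simp only [State.velocity, State.spin, timeDeriv]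
  ring

/-- The weak form of the mixed problem: integration by parts in time and in space. -/
lemma StandingAssumptions.firstVariation_eq (hP : P.StandingAssumptions) (h : s.Smooth)
    (hδ : δs.IsVariation P.body P.t₀ P.t₁ P.ρ P.J) :
    P.firstVariation s δs = ∫ z, P.residualWork s δs z ∂spaceTimeMeasure P.t₀ P.t₁ P.body
      + ∫ z, P.dispDensity { s with stress := δs.stress, couple := δs.couple } z
          ∂spaceTimeSurfaceMeasure P.t₀ P.t₁ P.dispPart
      + ∫ z, P.tractionResidual s δs z ∂spaceTimeSurfaceMeasure P.t₀ P.t₁ P.tractionPart := by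
  have hB := hP.body_lipschitz
  have h' := hδ.admissible.smooth
  have hd1 : VecC 1 δs.disp := h'.disp.mono one_le_two
  have hr1 : VecC 1 δs.rot := h'.rot.mono one_le_two
  have hfm : MeasurableSet (frontier P.body) := isClosed_frontier.measurableSet
  set g : ℝ × Space → ℝ := fun z => s.linMomentum P.ρ z.1 z.2 ⬝ᵥ δs.disp z.1 z.2
      + s.angMomentum P.J z.1 z.2 ⬝ᵥ δs.rot z.1 z.2 with hg
  have hgc : ContDiff ℝ 1 g := (contDiff_dotProduct (h.linMomentum P.ρ) hd1).add
    (contDiff_dotProduct (h.angMomentum P.J) hr1)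
  have ht : ∫ z : ℝ × Space, deriv (fun τ => g (τ, z.2)) z.1
      ∂spaceTimeMeasure P.t₀ P.t₁ P.body = 0 := by
    refine integral_deriv_time_eq_zero hP.time_lt.le hB.2.1 hgc (fun x hx => ?_) fun x hx => ?_
    · simp [hg, (hδ.disp_ends x hx).1, (hδ.rot_ends x hx).1]
    · simp [hg, (hδ.disp_ends x hx).2, (hδ.rot_ends x hx).2]
  have hgrad : ∀ v : ℝ → Space → Vec, VecC 1 v →
      Continuous fun z : ℝ × Space => (grad (v z.1) z.2)ᵀ := fun v hv =>
    continuous_pi fun i => continuous_pi fun j =>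
      (contDiff_partialDeriv (g := fun z => v z.1 z.2 i) (n := 0)
        (by simpa using hv i) j).continuous
  have c1 : Continuous fun z : ℝ × Space => div (s.stress z.1) z.2 ⬝ᵥ δs.disp z.1 z.2
      + ddot (s.stress z.1 z.2) (grad (δs.disp z.1) z.2)ᵀ :=
    (h.stress.continuous_div.dotProduct hd1.continuous).add
    (continuous_ddot h.stress.continuous (hgrad _ hd1))
  have c2 : Continuous fun z : ℝ × Space => div (s.couple z.1) z.2 ⬝ᵥ δs.rot z.1 z.2
      + ddot (s.couple z.1 z.2) (grad (δs.rot z.1) z.2)ᵀ :=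
    (h.couple.continuous_div.dotProduct hr1.continuous).add
    (continuous_ddot h.couple.continuous (hgrad _ hr1))
  have c0 : Continuous fun z : ℝ × Space => deriv (fun τ => g (τ, z.2)) z.1 :=
    (contDiff_deriv_time (n := 0) (by simpa using hgc)).continuous
  have cr := continuous_residualWork (P := P) h h'
  have hint : ∀ {f : ℝ × Space → ℝ}, Continuous f →
      Integrable f (spaceTimeMeasure P.t₀ P.t₁ P.body) := fun hf =>
    integrable_spaceTimeMeasure hB.2.1 hf
  have hbulk : ∫ z, P.bulkVariation s δs z ∂spaceTimeMeasure P.t₀ P.t₁ P.body =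
      ∫ z, P.residualWork s δs z ∂spaceTimeMeasure P.t₀ P.t₁ P.body
        - ∫ z, P.boundaryWork s δs z
          ∂spaceTimeSurfaceMeasure P.t₀ P.t₁ (frontier P.body) := by
    have e : P.bulkVariation s δs =ᵐ[spaceTimeMeasure P.t₀ P.t₁ P.body] fun z =>
        P.residualWork s δs z + deriv (fun τ => g (τ, z.2)) z.1
        - (div (s.stress z.1) z.2 ⬝ᵥ δs.disp z.1 z.2
          + ddot (s.stress z.1 z.2) (grad (δs.disp z.1) z.2)ᵀ)
        - (div (s.couple z.1) z.2 ⬝ᵥ δs.rot z.1 z.2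
          + ddot (s.couple z.1 z.2) (grad (δs.rot z.1) z.2)ᵀ) := by
      filter_upwards [ae_mem_spaceTimeMeasure hB.1.measurableSet] with z hz
      exact bulkVariation_eq h h' (hδ.admissible.kinematic z.1 hz.1 z.2 hz.2)
    have cr0 : Continuous fun z : ℝ × Space =>
        P.residualWork s δs z + deriv (fun τ => g (τ, z.2)) z.1 := cr.add c0
    rw [integral_congr_ae e, integral_sub (hint (cr0.fun_sub c1)) (hint c2),
      integral_sub (hint cr0) (hint c1), integral_add (hint cr) (hint c0), ht,
      integral_div_contract hP h.stress hd1, integral_div_contract hP h.couple hr1]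
    unfold boundaryWork
    rw [integral_add
      (integrable_traction_dotProduct hB hfm subset_rfl h.stress.continuous
        (integrable_continuous_vec hB hfm subset_rfl hd1.continuous))
      (integrable_traction_dotProduct hB hfm subset_rfl h.couple.continuous
        (integrable_continuous_vec hB hfm subset_rfl hr1.continuous))]
    ring
  have hsplit := integral_spaceTimeSurfaceMeasure_add_diff hB hP.tractionPart_measurable
    hP.tractionPart_subset (integrable_boundaryWork hB hfm subset_rfl h h')
  unfold firstVariation tractionResidual
  rw [hbulk, hsplit, integral_add (hP.integrable_dispDensity (smooth_withStress h h'))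
      (integrable_boundaryWork hB hP.measurable_dispPart P.dispPart_subset h h'),
    integral_sub (hP.integrable_tractionDensity h') (integrable_boundaryWork hB
      hP.tractionPart_measurable hP.tractionPart_subset h h')]
  simp only [dispPart]
  ring

end Problem

open scoped ContDiff


/-! ### Test variations -/

/-- The kinematically admissible state with displacement `ψ • a`, rotation `ψ • b`, stress `ψ • C`
and couple stress `ψ • D`. -/
noncomputable def testState (ψ : ℝ × Space → ℝ) (a b : Vec) (C D : Tensor) : State where
  disp := fun t x => ψ (t, x) • a
  rot := fun t x => ψ (t, x) • b
  strain := fun t x => (grad (fun y => ψ (t, y) • a) x)ᵀ + epsVec (ψ (t, x) • b)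
  torsion := fun t x => (grad (fun y => ψ (t, y) • b) x)ᵀ
  stress := fun t x => ψ (t, x) • C
  couple := fun t x => ψ (t, x) • D

section TestState

variable {ψ : ℝ × Space → ℝ} {t₀ t₁ : ℝ}

lemma vecC_smul_const (hψ : ContDiff ℝ ∞ ψ) (a : Vec) (n : ℕ) :
    VecC n fun t x => ψ (t, x) • a :=
  fun _ => (hψ.of_le (by exact_mod_cast le_top)).mul contDiff_const

lemma tensorC1_smul_const (hψ : ContDiff ℝ ∞ ψ) (C : Tensor) :
    TensorC1 fun t x => ψ (t, x) • C :=
  fun _ _ => (hψ.of_le (by exact_mod_cast le_top)).mul contDiff_const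

lemma tensorC1_grad_transpose {v : ℝ → Space → Vec} (hv : VecC 2 v) :
    TensorC1 fun t x => (grad (v t) x)ᵀ := fun i j =>
  contDiff_partialDeriv (g := fun z => v z.1 z.2 i) (n := 1)
    (by simpa [one_add_one_eq_two] using hv i) j

lemma tensorC1_epsVec {v : ℝ → Space → Vec} (hv : VecC 1 v) :
    TensorC1 fun t x => epsVec (v t x) := fun i j => by
  simp only [epsVec, of_apply]
  exact ContDiff.sum fun k _ => contDiff_const.mul (hv k)

lemma timeDeriv_smul_const_eq_zero {t : ℝ} {x : Space} (h : (t, x) ∉ tsupport ψ) (a : Vec) :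
    timeDeriv (fun t x => ψ (t, x) • a) t x = 0 := by
  have h1 : ∀ᶠ τ in 𝓝 t, ψ (τ, x) = 0 :=
    (Continuous.prodMk_left x).continuousAt.eventually (notMem_tsupport_iff_eventuallyEq.1 h)
  have h2 : (fun τ => ψ (τ, x) • a) =ᶠ[𝓝 t] fun _ => 0 := by
    filter_upwards [h1] with τ hτ
    rw [hτ, zero_smul]
  rw [timeDeriv, h2.deriv_eq, deriv_const]

lemma testState_isVariation (hψ : ContDiff ℝ ∞ ψ) (hs : tsupport ψ ⊆ Ioo t₀ t₁ ×ˢ univ)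
    (a b : Vec) (C D : Tensor) (B : Set Space) (ρ : ℝ) (J : Tensor) :
    (testState ψ a b C D).IsVariation B t₀ t₁ ρ J := by
  have n₀ : ∀ x, (t₀, x) ∉ tsupport ψ := fun x hx => lt_irrefl _ (hs hx).1.1
  have n₁ : ∀ x, (t₁, x) ∉ tsupport ψ := fun x hx => lt_irrefl _ (hs hx).1.2
  have z₀ : ∀ x, ψ (t₀, x) = 0 := fun x => image_eq_zero_of_notMem_tsupport (n₀ x)
  have z₁ : ∀ x, ψ (t₁, x) = 0 := fun x => image_eq_zero_of_notMem_tsupport (n₁ x)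
  refine ⟨⟨vecC_smul_const hψ a 2, vecC_smul_const hψ b 2, fun i j => ?_,
    tensorC1_grad_transpose (vecC_smul_const hψ b 2), tensorC1_smul_const hψ C,
    tensorC1_smul_const hψ D, fun t _ x _ => ⟨rfl, rfl⟩⟩, fun x _ => ?_, fun x _ => ?_,
    fun x _ => ?_, fun x _ => ?_⟩
  · exact (tensorC1_grad_transpose (vecC_smul_const hψ a 2) i j).add
      (tensorC1_epsVec (vecC_smul_const hψ b 1) i j)
  · simp [testState, z₀, z₁]
  · simp [testState, z₀, z₁]
  · have h₀ : (testState ψ a b C D).velocity t₀ x = 0 := timeDeriv_smul_const_eq_zero (n₀ x) a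
    have h₁ : (testState ψ a b C D).velocity t₁ x = 0 := timeDeriv_smul_const_eq_zero (n₁ x) a
    simp [State.linMomentum, h₀, h₁]
  · have h₀ : (testState ψ a b C D).spin t₀ x = 0 := timeDeriv_smul_const_eq_zero (n₀ x) b
    have h₁ : (testState ψ a b C D).spin t₁ x = 0 := timeDeriv_smul_const_eq_zero (n₁ x) b
    simp [State.angMomentum, h₀, h₁]

lemma testState_smooth (hψ : ContDiff ℝ ∞ ψ) (a b : Vec) (C D : Tensor) :
    (testState ψ a b C D).Smooth :=
  ⟨vecC_smul_const hψ a 2, vecC_smul_const hψ b 2, fun i j =>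
    (tensorC1_grad_transpose (vecC_smul_const hψ a 2) i j).add
      (tensorC1_epsVec (vecC_smul_const hψ b 1) i j),
    tensorC1_grad_transpose (vecC_smul_const hψ b 2), tensorC1_smul_const hψ C,
    tensorC1_smul_const hψ D⟩

end TestState

/-! ### The fundamental lemma of the calculus of variations on cylinders -/

section Fundamental

variable {B G : Set Space} {t₀ t₁ : ℝ}

lemma eq_zero_of_forall_integral_mul_eq_zero (ht : t₀ < t₁) (hB : IsOpen B) {f : ℝ × Space → ℝ}
    (hf : Continuous f)
    (h : ∀ ψ : ℝ × Space → ℝ, ContDiff ℝ ∞ ψ → tsupport ψ ⊆ Ioo t₀ t₁ ×ˢ B →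
      ∫ z, ψ z * f z ∂spaceTimeMeasure t₀ t₁ B = 0) :
    ∀ t ∈ Icc t₀ t₁, ∀ x ∈ B, f (t, x) = 0 := by
  have hU : IsOpen (Ioo t₀ t₁ ×ˢ B) := isOpen_Ioo.prod hB
  rw [spaceTimeMeasure_eq_restrict] at h
  have h1 := hU.ae_eq_zero_of_integral_contDiff_smul_eq_zero
    (hf.locallyIntegrable.locallyIntegrableOn _) fun ψ hψ _ hs => h ψ hψ hs
  have h2 : f =ᵐ[(volume : Measure (ℝ × Space)).restrict (Ioo t₀ t₁ ×ˢ B)] fun _ => 0 := by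
    have h3 := ae_restrict_of_ae_restrict_of_subset
      (prod_mono (Ioo_subset_Icc_self (a := t₀) (b := t₁)) (subset_refl B)) h1
    filter_upwards [h3, ae_restrict_mem hU.measurableSet] with z hz hz' using hz hz'
  have h4 := (Measure.eqOn_open_of_ae_eq h2 hU hf.continuousOn continuousOn_const).closure hf
    continuous_const
  intro t htI x hx
  refine h4 ?_
  rw [closure_prod_eq, closure_Ioo ht.ne]
  exact ⟨htI, subset_closure hx⟩

lemma ae_eq_zero_of_forall_integral_mul_eq_zero (hB : IsLipschitzBody B) (hG : G ⊆ frontier B)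
    {f : ℝ × Space → ℝ} (hf : Integrable f (spaceTimeSurfaceMeasure t₀ t₁ G))
    (h : ∀ ψ : ℝ × Space → ℝ, ContDiff ℝ ∞ ψ → tsupport ψ ⊆ Ioo t₀ t₁ ×ˢ univ →
      ∫ z, ψ z * f z ∂spaceTimeSurfaceMeasure t₀ t₁ G = 0) :
    ∀ᵐ z ∂spaceTimeSurfaceMeasure t₀ t₁ G, f z = 0 := by
  have hU : IsOpen (Ioo t₀ t₁ ×ˢ (univ : Set Space)) := isOpen_Ioo.prod isOpen_univ
  have h1 := hU.ae_eq_zero_of_integral_contDiff_smul_eq_zero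
    (hf.locallyIntegrable.locallyIntegrableOn _) fun ψ hψ _ hs => h ψ hψ hs
  have h2 : ∀ᵐ z ∂spaceTimeSurfaceMeasure t₀ t₁ G, z.1 ∈ Ioo t₀ t₁ := by
    have := isFiniteMeasure_surfaceMeasure_of_subset hB hG
    rw [spaceTimeSurfaceMeasure, ← restrict_Ioo_eq_restrict_Icc]
    exact Measure.quasiMeasurePreserving_fst.ae (ae_restrict_mem measurableSet_Ioo)
  filter_upwards [h1, h2] with z hz hz' using hz ⟨hz', mem_univ _⟩

end Fundamental

namespace Problem

variable {P : Problem} {s : State}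

/-! ### The variational principle -/

/-- The residual work densities of a test state are those of its amplitudes, multiplied by its
profile. -/
lemma residualWork_testState (ψ : ℝ × Space → ℝ) (a b : Vec) (C D : Tensor) (z : ℝ × Space) :
    P.residualWork s (testState ψ a b C D) z =
      ψ z * P.residualWork s (testState (fun _ => 1) a b C D) z := by
  simp only [residualWork, testState, one_smul, Prod.mk.eta, ddot_smul_right, dotProduct_smul,
    smul_eq_mul]
  ring

lemma dispDensity_testState (ψ : ℝ × Space → ℝ) (a b : Vec) (C D : Tensor) (z : ℝ × Space) :
    P.dispDensity { s with stress := (testState ψ a b C D).stress,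
                           couple := (testState ψ a b C D).couple } z =
      ψ z * ((C *ᵥ P.normal z.2) ⬝ᵥ (s.disp z.1 z.2 - P.u₀ z.1 z.2)
        + (D *ᵥ P.normal z.2) ⬝ᵥ (s.rot z.1 z.2 - P.φ₀ z.1 z.2)) := by
  simp only [dispDensity, testState, Prod.mk.eta, smul_mulVec, smul_dotProduct, smul_eq_mul]
  ring

lemma tractionResidual_testState (ψ : ℝ × Space → ℝ) (a b : Vec) (C D : Tensor) (z : ℝ × Space) :
    P.tractionResidual s (testState ψ a b C D) z =
      ψ z * ((P.σ₀ z.1 z.2 - s.stress z.1 z.2 *ᵥ P.normal z.2) ⬝ᵥ a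
        + (P.μ₀ z.1 z.2 - s.couple z.1 z.2 *ᵥ P.normal z.2) ⬝ᵥ b) := by
  simp only [tractionResidual, tractionDensity, boundaryWork, testState, Prod.mk.eta,
    dotProduct_smul, smul_eq_mul, sub_dotProduct]
  ring

/-- The equations of the mixed problem make the weak form vanish. -/
lemma IsSolution.firstVariation_eq_zero (hP : P.StandingAssumptions) (h : s.Smooth)
    (hsol : P.IsSolution s) {δs : State} (hδ : δs.IsVariation P.body P.t₀ P.t₁ P.ρ P.J) :
    P.firstVariation s δs = 0 := by
  rw [hP.firstVariation_eq h hδ, integral_eq_zero_of_ae, integral_eq_zero_of_ae,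
    integral_eq_zero_of_ae, add_zero, add_zero]
  · filter_upwards [hsol.traction_boundary] with z hz
    simp [tractionResidual, tractionDensity, boundaryWork, hz.1, hz.2]
  · filter_upwards [hsol.disp_boundary] with z hz
    simp [dispDensity, hz.1, hz.2]
  · filter_upwards [ae_mem_spaceTimeMeasure hP.body_lipschitz.1.measurableSet] with z hz
    have e1 : div (s.stress z.1) z.2 = timeDeriv (s.linMomentum P.ρ) z.1 z.2 :=
      hsol.linear_balance z.1 hz.1 z.2 hz.2
    have e2 : epsTensor (s.stress z.1 z.2) + div (s.couple z.1) z.2 =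
        timeDeriv (s.angMomentum P.J) z.1 z.2 := hsol.angular_balance z.1 hz.1 z.2 hz.2
    simp [residualWork, e1, e2, hsol.strain_eq z.1 hz.1 z.2 hz.2,
      hsol.torsion_eq z.1 hz.1 z.2 hz.2, ddot]

/-- Test variations supported inside the body, multiplied by arbitrary amplitudes, show that all
residuals vanish in the body. -/
lemma residualWork_eq_zero (hP : P.StandingAssumptions) (h : s.Smooth)
    (hst : ∀ δs : State, δs.IsVariation P.body P.t₀ P.t₁ P.ρ P.J → P.firstVariation s δs = 0)
    (a b : Vec) (C D : Tensor) : ∀ t ∈ Icc P.t₀ P.t₁, ∀ x ∈ P.body,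
      P.residualWork s (testState (fun _ => 1) a b C D) (t, x) = 0 := by
  have hB := hP.body_lipschitz
  refine eq_zero_of_forall_integral_mul_eq_zero hP.time_lt hB.1
    (continuous_residualWork h (testState_smooth contDiff_const a b C D)) fun ψ hψ hs => ?_
  have hvar := testState_isVariation hψ (hs.trans (prod_mono subset_rfl (subset_univ _)))
    a b C D P.body P.ρ P.J
  have hψ0 : ∀ z : ℝ × Space, z.2 ∈ frontier P.body → ψ z = 0 := fun z hz =>
    image_eq_zero_of_notMem_tsupport fun hz' => by
      rw [hB.1.frontier_eq] at hz
      exact hz.2 (hs hz').2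
  have h0 := hst _ hvar
  rw [hP.firstVariation_eq h hvar] at h0
  simp only [residualWork_testState ψ, dispDensity_testState ψ, tractionResidual_testState ψ] at h0
  rw [integral_eq_zero_of_ae (μ := spaceTimeSurfaceMeasure P.t₀ P.t₁ P.dispPart),
    integral_eq_zero_of_ae (μ := spaceTimeSurfaceMeasure P.t₀ P.t₁ P.tractionPart),
    add_zero, add_zero] at h0
  · exact h0
  · filter_upwards [ae_mem_spaceTimeSurfaceMeasure hB hP.tractionPart_measurable
      hP.tractionPart_subset] with z hz
    simp [hψ0 z (hP.tractionPart_subset hz.2)]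
  · filter_upwards [ae_mem_spaceTimeSurfaceMeasure hB hP.measurable_dispPart
      P.dispPart_subset] with z hz
    simp [hψ0 z (P.dispPart_subset hz.2)]

/-- Once the residuals in the body vanish, so does the boundary part of the weak form. -/
lemma boundary_weak_form (hP : P.StandingAssumptions) (h : s.Smooth)
    (hst : ∀ δs : State, δs.IsVariation P.body P.t₀ P.t₁ P.ρ P.J → P.firstVariation s δs = 0)
    (a b : Vec) (C D : Tensor) {ψ : ℝ × Space → ℝ} (hψ : ContDiff ℝ ∞ ψ)
    (hs : tsupport ψ ⊆ Ioo P.t₀ P.t₁ ×ˢ univ) :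
    ∫ z, ψ z * ((C *ᵥ P.normal z.2) ⬝ᵥ (s.disp z.1 z.2 - P.u₀ z.1 z.2)
        + (D *ᵥ P.normal z.2) ⬝ᵥ (s.rot z.1 z.2 - P.φ₀ z.1 z.2))
        ∂spaceTimeSurfaceMeasure P.t₀ P.t₁ P.dispPart
      + ∫ z, ψ z * ((P.σ₀ z.1 z.2 - s.stress z.1 z.2 *ᵥ P.normal z.2) ⬝ᵥ a
        + (P.μ₀ z.1 z.2 - s.couple z.1 z.2 *ᵥ P.normal z.2) ⬝ᵥ b)
        ∂spaceTimeSurfaceMeasure P.t₀ P.t₁ P.tractionPart = 0 := by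
  have hvar := testState_isVariation hψ hs a b C D P.body P.ρ P.J
  have h0 := hst _ hvar
  rw [hP.firstVariation_eq h hvar] at h0
  simp only [residualWork_testState ψ, dispDensity_testState ψ, tractionResidual_testState ψ] at h0
  rw [integral_eq_zero_of_ae (μ := spaceTimeMeasure P.t₀ P.t₁ P.body), zero_add] at h0
  · exact h0
  · filter_upwards [ae_mem_spaceTimeMeasure hP.body_lipschitz.1.measurableSet] with z hz
    simp [residualWork_eq_zero hP h hst a b C D z.1 hz.1 z.2 hz.2]

/-- Variations of the stresses enforce the boundary conditions on displacement and rotation: they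
show `(u - u₀) ⊗ n = 0` and `(φ - φ₀) ⊗ n = 0`, and the normal does not vanish. -/
lemma disp_boundary_of_firstVariation (hP : P.StandingAssumptions) (h : s.Smooth)
    (hst : ∀ δs : State, δs.IsVariation P.body P.t₀ P.t₁ P.ρ P.J → P.firstVariation s δs = 0) :
    ∀ᵐ z ∂(spaceTimeSurfaceMeasure P.t₀ P.t₁ P.dispPart),
      s.disp z.1 z.2 = P.u₀ z.1 z.2 ∧ s.rot z.1 z.2 = P.φ₀ z.1 z.2 := by
  have hB := hP.body_lipschitz
  have hdm := hP.measurable_dispPart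
  have hds := P.dispPart_subset
  have key : ∀ C D : Tensor, ∀ᵐ z ∂(spaceTimeSurfaceMeasure P.t₀ P.t₁ P.dispPart),
      (C *ᵥ P.normal z.2) ⬝ᵥ (s.disp z.1 z.2 - P.u₀ z.1 z.2)
        + (D *ᵥ P.normal z.2) ⬝ᵥ (s.rot z.1 z.2 - P.φ₀ z.1 z.2) = 0 := by
    intro C D
    refine ae_eq_zero_of_forall_integral_mul_eq_zero hB hds ?_ fun ψ hψ hs => ?_
    · exact (integrable_traction_dotProduct hB hdm hds continuous_const
        ((integrable_continuous_vec hB hdm hds h.disp.continuous).sub hP.u₀_integrable)).add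
        (integrable_traction_dotProduct hB hdm hds continuous_const
        ((integrable_continuous_vec hB hdm hds h.rot.continuous).sub hP.φ₀_integrable))
    · simpa using boundary_weak_form hP h hst 0 0 C D hψ hs
  have hn : ∀ᵐ z ∂(spaceTimeSurfaceMeasure P.t₀ P.t₁ P.dispPart), P.normal z.2 ≠ 0 := by
    have := isFiniteMeasure_surfaceMeasure_of_subset hB hds
    have h1 : ∀ᵐ x ∂surfaceMeasure P.dispPart, P.normal x ≠ 0 := by
      filter_upwards [ae_mono (Measure.restrict_mono_set _ hds) hB.ae_exists_normal] with x hx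
      exact outwardNormal_ne_zero hx
    exact Measure.quasiMeasurePreserving_snd.ae h1
  have k1 : ∀ᵐ z ∂(spaceTimeSurfaceMeasure P.t₀ P.t₁ P.dispPart), ∀ i j,
      P.normal z.2 j * (s.disp z.1 z.2 - P.u₀ z.1 z.2) i = 0 := by
    simp only [ae_all_iff]
    intro i j
    filter_upwards [key (Matrix.single i j 1) 0] with z hz
    simpa [single_mulVec, Function.update_eq_self, dotProduct, Function.update_apply] using hz
  have k2 : ∀ᵐ z ∂(spaceTimeSurfaceMeasure P.t₀ P.t₁ P.dispPart), ∀ i j,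
      P.normal z.2 j * (s.rot z.1 z.2 - P.φ₀ z.1 z.2) i = 0 := by
    simp only [ae_all_iff]
    intro i j
    filter_upwards [key 0 (Matrix.single i j 1)] with z hz
    simpa [single_mulVec, Function.update_eq_self, dotProduct, Function.update_apply] using hz
  filter_upwards [k1, k2, hn] with z h1 h2 hz
  obtain ⟨j, hj⟩ := Function.ne_iff.1 hz
  exact ⟨funext fun i => sub_eq_zero.1 ((mul_eq_zero.1 (h1 i j)).resolve_left hj),
    funext fun i => sub_eq_zero.1 ((mul_eq_zero.1 (h2 i j)).resolve_left hj)⟩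

/-- Variations of displacement and rotation enforce the traction boundary conditions. -/
lemma traction_boundary_of_firstVariation (hP : P.StandingAssumptions) (h : s.Smooth)
    (hst : ∀ δs : State, δs.IsVariation P.body P.t₀ P.t₁ P.ρ P.J → P.firstVariation s δs = 0) :
    ∀ᵐ z ∂(spaceTimeSurfaceMeasure P.t₀ P.t₁ P.tractionPart),
      s.stress z.1 z.2 *ᵥ P.normal z.2 = P.σ₀ z.1 z.2 ∧
      s.couple z.1 z.2 *ᵥ P.normal z.2 = P.μ₀ z.1 z.2 := by
  have hB := hP.body_lipschitz
  have hGm := hP.tractionPart_measurable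
  have hGs := hP.tractionPart_subset
  have key : ∀ a b : Vec, ∀ᵐ z ∂(spaceTimeSurfaceMeasure P.t₀ P.t₁ P.tractionPart),
      (P.σ₀ z.1 z.2 - s.stress z.1 z.2 *ᵥ P.normal z.2) ⬝ᵥ a
        + (P.μ₀ z.1 z.2 - s.couple z.1 z.2 *ᵥ P.normal z.2) ⬝ᵥ b = 0 := by
    intro a b
    refine ae_eq_zero_of_forall_integral_mul_eq_zero hB hGs ?_ fun ψ hψ hs => ?_
    · have hc : (testState (fun _ => 1) a b 0 0).Smooth := testState_smooth contDiff_const a b 0 0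
      refine ((hP.integrable_tractionDensity hc).sub
        (integrable_boundaryWork hB hGm hGs h hc)).congr (Filter.Eventually.of_forall fun z => ?_)
      have := tractionResidual_testState (P := P) (s := s) (fun _ => 1) a b 0 0 z
      rw [one_mul] at this
      exact this
    · simpa using boundary_weak_form hP h hst a b 0 0 hψ hs
  have k1 : ∀ᵐ z ∂(spaceTimeSurfaceMeasure P.t₀ P.t₁ P.tractionPart), ∀ i,
      (P.σ₀ z.1 z.2 - s.stress z.1 z.2 *ᵥ P.normal z.2) i = 0 := by
    simp only [ae_all_iff]
    intro i
    filter_upwards [key (Pi.single i 1) 0] with z hz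
    simpa using hz
  have k2 : ∀ᵐ z ∂(spaceTimeSurfaceMeasure P.t₀ P.t₁ P.tractionPart), ∀ i,
      (P.μ₀ z.1 z.2 - s.couple z.1 z.2 *ᵥ P.normal z.2) i = 0 := by
    simp only [ae_all_iff]
    intro i
    filter_upwards [key 0 (Pi.single i 1)] with z hz
    simpa using hz
  filter_upwards [k1, k2] with z h1 h2
  exact ⟨funext fun i => (sub_eq_zero.1 (h1 i)).symm, funext fun i => (sub_eq_zero.1 (h2 i)).symm⟩

/-- A state whose first variation vanishes solves the mixed problem. -/
lemma isSolution_of_firstVariation (hP : P.StandingAssumptions) (h : s.Smooth)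
    (hst : ∀ δs : State, δs.IsVariation P.body P.t₀ P.t₁ P.ρ P.J → P.firstVariation s δs = 0) :
    P.IsSolution s := by
  have key := residualWork_eq_zero hP h hst
  simp only [residualWork, testState, one_smul] at key
  refine ⟨fun t ht x hx => ?_, fun t ht x hx => ?_, fun t ht x hx => ?_, fun t ht x hx => ?_,
    disp_boundary_of_firstVariation hP h hst, traction_boundary_of_firstVariation hP h hst⟩
  -- each residual vanishes since it can be tested with itself
  · have := key (div (s.stress t) x - timeDeriv (s.linMomentum P.ρ) t x) 0 0 0 t ht x hx
    change _ = timeDeriv (s.linMomentum P.ρ) t x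
    exact sub_eq_zero.1 (dotProduct_self_eq_zero.1 (by simpa [ddot] using this))
  · have := key 0 (epsTensor (s.stress t x) + div (s.couple t) x
      - timeDeriv (s.angMomentum P.J) t x) 0 0 t ht x hx
    change _ = timeDeriv (s.angMomentum P.J) t x
    exact sub_eq_zero.1 (dotProduct_self_eq_zero.1 (by simpa [ddot] using this))
  · have := key 0 0 (P.moduli.strainOfStress (s.stress t x) - s.strain t x) 0 t ht x hx
    exact (sub_eq_zero.1 (ddot_eq_zero_of_self (by simpa [ddot] using this))).symm
  · have := key 0 0 0 (P.moduli.torsionOfCouple (s.couple t x) - s.torsion t x) t ht x hx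
    exact (sub_eq_zero.1 (ddot_eq_zero_of_self (by simpa [ddot] using this))).symm

end Problem

end Cosserat

theorem mainTheorem1 (P : Cosserat.Problem) (hP : P.StandingAssumptions) (s : Cosserat.State)
    (hs : s.Admissible P.body P.t₀ P.t₁) :
    P.Stationary s ↔ P.IsSolution s := by
  rw [hP.stationary_iff hs.smooth]
  exact ⟨Cosserat.Problem.isSolution_of_firstVariation hP hs.smooth,
    fun hsol _ hδ => hsol.firstVariation_eq_zero hP hs.smooth hδ⟩
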